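/- Let $d\ge 2$ and let $\Omega_1,\Omega_2\subset\mathbb R^d$ be open, with $\overline{\Omega_2}$ a compact subset of $\Omega_1$. For an open set $\Omega\subset\mathbb R^d$ let $h^2(\Omega)$ be the harmonic Bergman space, i.e. the Hilbert space of complex-valued $f\in L^2(\Omega)$ (Lebesgue measure) with $\Delta f=0$ in the sense of distributions on $\Omega$ (equivalently, by Weyl's lemma, of square-integrable harmonic functions), with the $L^2$ inner product, and let $J:h^2(\Omega_1)\to h^2(\Omega_2)$ be the restriction map. Let $N\ge 1$, and let $B_1,\dots,B_N$ be open Euclidean balls of positive radius and $\gamma_1,\dots,\gamma_N>1$ real numbers such that $$\Omega_2\subset\bigcup_{n=1}^N B_n\qquad\text{and}\qquad \bigcup_{n=1}^N B_n(\gamma_n)\subset\Omega_1,$$ where $B(\gamma)$ denotes the ball with the same centre as $B$ and $\gamma$ times its radius. (That is, $B_1,\dots,B_N$ is a relative cover of $(\Omega_1,\Omega_2)$ of size $N$ with efficiency $\Gamma=(\log\gamma_1,\dots,\log\gamma_N)$.) Put $$\|\Gamma\|=\min_{1\le j\le N}\log\gamma_j,\qquad \|\Gamma\|_{d-1}=\Big(\sum_{j=1}^N(\log\gamma_j)^{-(d-1)}\Big)^{-1/(d-1)},\qquad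 c=\Big(\frac{(d-1)!}{2}\Big)^{1/(d-1)}\|\Gamma\|_{d-1}.$$ For a compact operator $A$ between Hilbert spaces let $s_n(A)=\sqrt{\lambda_n(A^*A)}$, $n\ge1$, be its singular values, where $\lambda_1(A^*A)\ge\lambda_2(A^*A)\ge\cdots$ are the eigenvalues of $A^*A$ repeated according to multiplicity (and followed by zeros if there are only finitely many nonzero ones). Then $J$ is compact and $$\sup_{n\ge1}\, s_n(J)\exp\big(c\,n^{1/(d-1)}\big)\le N\exp\big(-\|\Gamma\|/2\big);$$ that is, $J$ belongs to the exponential class $E(c,1/(d-1))$ with gauge $|J|_{c,1/(d-1)}\le N e^{-\|\Gamma\|/2}$. In particular $s_n(J)\le N e^{-\|\Gamma\|/2}\exp(-c\,n^{1/(d-1)})$ for all $n\ge1$. -/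

import Mathlib

open MeasureTheory Set Filter Topology
open scoped ENNReal ContDiff InnerProductSpace Laplacian

noncomputable section

/-! ### Eigenvalues, singular values, exponential classes -/

/-- The modulus `|λ_n(T)|` (`n ≥ 1`) of the `n`-th eigenvalue of a compact operator `T`, the
eigenvalues being repeated according to algebraic multiplicity and ordered by decreasing modulus;
it is `0` if `T` has fewer than `n` nonzero eigenvalues. It is the largest `r > 0` such
that the eigenvalues `μ` with `r ≤ |μ|` have total algebraic multiplicity at least `n`; this total
multiplicity is the dimension of the (direct) sum of the corresponding generalized eigenspaces. -/
def eigenvalueModulus {H : Type*} [NormedAddCommGroup H] [NormedSpace ℂ H]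
    (T : H →L[ℂ] H) (n : ℕ) : ℝ :=
  sSup {r : ℝ | 0 < r ∧
    (n : Cardinal) ≤ Module.rank ℂ
      ↥(⨆ μ : {μ : ℂ // r ≤ ‖μ‖}, Module.End.maxGenEigenspace (T : Module.End ℂ H) (μ : ℂ))}

section Operators

variable {H₁ H₂ : Type*} [NormedAddCommGroup H₁] [InnerProductSpace ℂ H₁] [CompleteSpace H₁]
  [NormedAddCommGroup H₂] [InnerProductSpace ℂ H₂] [CompleteSpace H₂]

/-- The `n`-th singular value `s_n(A) = √(λ_n(A* A))`, `n ≥ 1`. The eigenvalues of `A* A` are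
nonnegative reals, so they coincide with their moduli. -/
def singularValue (A : H₁ →L[ℂ] H₂) (n : ℕ) : ℝ :=
  √(eigenvalueModulus (ContinuousLinearMap.adjoint A ∘L A) n)

/-- The exponential class `E(a, α; H₁, H₂)` of operators of type `(a, α)`: the compact operators
with `sup_{n ≥ 1} s_n(A) exp(a n ^ α) < ∞`. -/
def expClass (H₁ H₂ : Type*) [NormedAddCommGroup H₁] [InnerProductSpace ℂ H₁] [CompleteSpace H₁]
    [NormedAddCommGroup H₂] [InnerProductSpace ℂ H₂] [CompleteSpace H₂] (a α : ℝ) :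
    Set (H₁ →L[ℂ] H₂) :=
  {A | IsCompactOperator A ∧
    BddAbove (range fun n : ℕ+ => singularValue A n * Real.exp (a * (n : ℝ) ^ α))}

/-- The `(a, α)`-gauge `|A|_{a, α} = sup_{n ≥ 1} s_n(A) exp(a n ^ α)` of `A ∈ E(a, α)`. -/
def expGauge (a α : ℝ) (A : H₁ →L[ℂ] H₂) : ℝ :=
  ⨆ n : ℕ+, singularValue A n * Real.exp (a * (n : ℝ) ^ α)

end Operators

/-! ### Harmonic Bergman spaces and canonical identifications -/

section Bergman

variable {d : ℕ}

/-- `φ` is a (real) test function on `Ω`: smooth with compact support contained in `Ω`. -/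
structure IsTestFunction (Ω : Set (EuclideanSpace ℝ (Fin d)))
    (φ : EuclideanSpace ℝ (Fin d) → ℝ) : Prop where
  smooth : ContDiff ℝ ∞ φ
  compact : HasCompactSupport φ
  subset : tsupport φ ⊆ Ω

lemma support_laplacian_subset (φ : EuclideanSpace ℝ (Fin d) → ℝ) :
    Function.support (Δ φ) ⊆ tsupport φ := by
  intro x hx
  by_contra h
  apply hx
  have h0 : φ =ᶠ[𝓝 x] 0 := notMem_tsupport_iff_eventuallyEq.mp h
  have := (InnerProductSpace.laplacian_congr_nhds h0).self_of_nhds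
  rw [this, InnerProductSpace.laplacian_eq_iteratedFDeriv_stdOrthonormalBasis]
  have : iteratedFDeriv ℝ 2 (0 : EuclideanSpace ℝ (Fin d) → ℝ) = 0 := iteratedFDeriv_fun_zero
  simp [this]

lemma IsTestFunction.continuous_laplacian {Ω : Set (EuclideanSpace ℝ (Fin d))}
    {φ : EuclideanSpace ℝ (Fin d) → ℝ} (hφ : IsTestFunction Ω φ) : Continuous (Δ φ) := by
  rw [InnerProductSpace.laplacian_eq_iteratedFDeriv_stdOrthonormalBasis]
  have : Continuous (iteratedFDeriv ℝ 2 φ) :=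
    hφ.smooth.continuous_iteratedFDeriv (WithTop.coe_le_coe.mpr le_top)
  fun_prop

lemma IsTestFunction.memLp_laplacian {Ω : Set (EuclideanSpace ℝ (Fin d))}
    {φ : EuclideanSpace ℝ (Fin d) → ℝ} (hφ : IsTestFunction Ω φ)
    (μ : Measure (EuclideanSpace ℝ (Fin d))) [IsFiniteMeasureOnCompacts μ] :
    MemLp (fun x => ((Δ φ x : ℝ) : ℂ)) 2 μ := by
  have hs : Function.support (fun x => ((Δ φ x : ℝ) : ℂ)) ⊆ tsupport φ := fun x hx =>
    support_laplacian_subset φ fun h0 => hx (by simp only [h0, Complex.ofReal_zero])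
  have hc : HasCompactSupport (fun x => ((Δ φ x : ℝ) : ℂ)) :=
    HasCompactSupport.of_support_subset_isCompact hφ.compact hs
  have hcont : Continuous (fun x => ((Δ φ x : ℝ) : ℂ)) :=
    Complex.continuous_ofReal.comp hφ.continuous_laplacian
  exact hcont.memLp_of_hasCompactSupport hc

/-- The pairing `f ↦ ∫_Ω f Δφ` as an inner product on `L²(Ω)`. -/
lemma IsTestFunction.inner_laplacian {Ω : Set (EuclideanSpace ℝ (Fin d))}
    {φ : EuclideanSpace ℝ (Fin d) → ℝ} (hφ : IsTestFunction Ω φ)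
    (f : Lp ℂ 2 (volume.restrict Ω)) :
    inner ℂ ((hφ.memLp_laplacian (volume.restrict Ω)).toLp _) f = ∫ x in Ω, Δ φ x • f x := by
  rw [L2.inner_def]
  refine integral_congr_ae ?_
  filter_upwards [(hφ.memLp_laplacian (volume.restrict Ω)).coeFn_toLp] with x hx
  rw [hx]
  simp [mul_comm]

/-- The harmonic Bergman space `h²(Ω) = {f ∈ L²(Ω) : Δ f = 0}` of complex-valued functions, as a
subspace of `L²(Ω)`; for an element `f` of `L²(Ω)` the equation `Δ f = 0` is
meant in the sense of distributions on `Ω`. -/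
def harmonicBergman (Ω : Set (EuclideanSpace ℝ (Fin d))) :
    Submodule ℂ (Lp ℂ 2 (volume.restrict Ω)) where
  carrier := {f | ∀ φ : EuclideanSpace ℝ (Fin d) → ℝ, IsTestFunction Ω φ →
    ∫ x in Ω, Δ φ x • f x = 0}
  zero_mem' φ hφ := by
    rw [← hφ.inner_laplacian, inner_zero_right]
  add_mem' {f g} hf hg φ hφ := by
    have h1 := hf φ hφ
    have h2 := hg φ hφ
    rw [← hφ.inner_laplacian] at h1 h2 ⊢
    rw [inner_add_right, h1, h2, add_zero]
  smul_mem' c f hf φ hφ := by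
    have h1 := hf φ hφ
    rw [← hφ.inner_laplacian] at h1 ⊢
    rw [inner_smul_right, h1, mul_zero]

lemma isClosed_harmonicBergman (Ω : Set (EuclideanSpace ℝ (Fin d))) :
    IsClosed (harmonicBergman Ω : Set (Lp ℂ 2 (volume.restrict Ω))) := by
  have : (harmonicBergman Ω : Set (Lp ℂ 2 (volume.restrict Ω))) =
      ⋂ (φ : EuclideanSpace ℝ (Fin d) → ℝ) (hφ : IsTestFunction Ω φ),
        {f | inner ℂ ((hφ.memLp_laplacian (volume.restrict Ω)).toLp _) f = 0} := by
    ext f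
    simp only [mem_iInter, mem_ofPred_eq]
    exact forall₂_congr fun φ hφ => by rw [hφ.inner_laplacian]
  rw [this]
  exact isClosed_iInter fun φ => isClosed_iInter fun hφ =>
    isClosed_eq (by fun_prop) continuous_const

instance instCompleteSpaceHarmonicBergman (Ω : Set (EuclideanSpace ℝ (Fin d))) :
    CompleteSpace (harmonicBergman Ω) :=
  (isClosed_harmonicBergman Ω).completeSpace_coe

lemma memLp_restrict_of_subset {Ω₁ Ω₂ : Set (EuclideanSpace ℝ (Fin d))} (h : Ω₂ ⊆ Ω₁)
    (f : Lp ℂ 2 (volume.restrict Ω₁)) : MemLp f 2 (volume.restrict Ω₂) :=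
  (Lp.memLp f).mono_measure (Measure.restrict_mono h le_rfl)

/-- Restriction of functions `L²(Ω₁) → L²(Ω₂)`, `Ω₂ ⊆ Ω₁`. -/
def restrictL2 {Ω₁ Ω₂ : Set (EuclideanSpace ℝ (Fin d))} (h : Ω₂ ⊆ Ω₁) :
    Lp ℂ 2 (volume.restrict Ω₁) →L[ℂ] Lp ℂ 2 (volume.restrict Ω₂) :=
  LinearMap.mkContinuous
    { toFun := fun f => (memLp_restrict_of_subset h f).toLp f
      map_add' := fun f g => by
        rw [← MemLp.toLp_add]
        exact MemLp.toLp_congr _ _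
          ((Measure.absolutelyContinuous_of_le (Measure.restrict_mono h le_rfl)).ae_eq
            (Lp.coeFn_add f g))
      map_smul' := fun c f => by
        rw [RingHom.id_apply, ← MemLp.toLp_const_smul]
        exact MemLp.toLp_congr _ _
          ((Measure.absolutelyContinuous_of_le (Measure.restrict_mono h le_rfl)).ae_eq
            (Lp.coeFn_smul c f)) }
    1 (fun f => by
      rw [one_mul]
      change ‖(memLp_restrict_of_subset h f).toLp f‖ ≤ ‖f‖
      rw [Lp.norm_toLp, Lp.norm_def]
      exact ENNReal.toReal_mono (Lp.eLpNorm_ne_top _)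
        (eLpNorm_mono_measure _ (Measure.restrict_mono h le_rfl)))

lemma coeFn_restrictL2 {Ω₁ Ω₂ : Set (EuclideanSpace ℝ (Fin d))} (h : Ω₂ ⊆ Ω₁)
    (f : Lp ℂ 2 (volume.restrict Ω₁)) : restrictL2 h f =ᵐ[volume.restrict Ω₂] f :=
  MemLp.coeFn_toLp (memLp_restrict_of_subset h f)

lemma restrictL2_mem_harmonicBergman {Ω₁ Ω₂ : Set (EuclideanSpace ℝ (Fin d))} (h : Ω₂ ⊆ Ω₁)
    {f : Lp ℂ 2 (volume.restrict Ω₁)} (hf : f ∈ harmonicBergman Ω₁) :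
    restrictL2 h f ∈ harmonicBergman Ω₂ := by
  intro φ hφ
  have h1 : ∫ x in Ω₁, Δ φ x • f x = 0 := hf φ ⟨hφ.smooth, hφ.compact, hφ.subset.trans h⟩
  have hz : ∀ x, x ∉ Ω₂ → Δ φ x • f x = 0 := by
    intro x hx
    have : Δ φ x = 0 := by
      by_contra h0
      exact hx (hφ.subset (support_laplacian_subset φ h0))
    rw [this, zero_smul]
  rw [setIntegral_eq_integral_of_forall_compl_eq_zero (fun x hx => hz x fun h2 => hx (h h2)),
    ← setIntegral_eq_integral_of_forall_compl_eq_zero hz] at h1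
  rw [← h1]
  refine integral_congr_ae ?_
  filter_upwards [coeFn_restrictL2 h f] with x hx
  rw [hx]

/-- The canonical identification `J : h²(Ω₁) → h²(Ω₂)`, `Ω₂ ⊆ Ω₁`: restriction of functions. -/
def canonicalIdentification {Ω₁ Ω₂ : Set (EuclideanSpace ℝ (Fin d))} (h : Ω₂ ⊆ Ω₁) :
    harmonicBergman Ω₁ →L[ℂ] harmonicBergman Ω₂ :=
  ((restrictL2 h).comp (harmonicBergman Ω₁).subtypeL).codRestrict (harmonicBergman Ω₂)
    (fun f => restrictL2_mem_harmonicBergman h f.2)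

end Bergman

/-! ### Relative covers -/

/-- `Ω₂` is compactly contained in `Ω₁`. -/
def CompactlyContained {X : Type*} [TopologicalSpace X] (Ω₂ Ω₁ : Set X) : Prop :=
  IsCompact (closure Ω₂) ∧ closure Ω₂ ⊆ Ω₁

lemma CompactlyContained.subset {X : Type*} [TopologicalSpace X] {Ω₂ Ω₁ : Set X}
    (h : CompactlyContained Ω₂ Ω₁) : Ω₂ ⊆ Ω₁ :=
  subset_closure.trans h.2

/-- The open balls `B_n` with centre `x n` and radius `r n` (`n = 1, …, N`) form a relative cover
of the pair `(Ω₁, Ω₂)` with scaling `(γ_1, …, γ_N)`. -/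
structure IsRelativeCover {d N : ℕ} (Ω₁ Ω₂ : Set (EuclideanSpace ℝ (Fin d)))
    (x : Fin N → EuclideanSpace ℝ (Fin d)) (r γ : Fin N → ℝ) : Prop where
  radius_pos : ∀ n, 0 < r n
  one_lt_scaling : ∀ n, 1 < γ n
  cover : Ω₂ ⊆ ⋃ n, Metric.ball (x n) (r n)
  dilation_subset : ⋃ n, Metric.ball (x n) (γ n * r n) ⊆ Ω₁

/-- The efficiency `Γ = (log γ_1, …, log γ_N)` of a relative cover with scaling `γ`. -/
def efficiency {N : ℕ} (γ : Fin N → ℝ) : Fin N → ℝ := fun n => Real.log (γ n)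

/-- `‖Γ‖ = min_j |Γ_j|` (for `N ≥ 1`). -/
def effMin {N : ℕ} (Γ : Fin N → ℝ) : ℝ := ⨅ j, |Γ j|

/-- `‖Γ‖_k = (∑_j |Γ_j| ^ (-k)) ^ (-1/k)`. -/
def effNorm {N : ℕ} (k : ℕ) (Γ : Fin N → ℝ) : ℝ :=
  (∑ j, (|Γ j| ^ k)⁻¹) ^ (-(1 / (k : ℝ)))

end

/-!
The singular value `s_n(J)` is at most the norm of `J` on any subspace of codimension less than `n`
(`singularValue_le_of_norm_le_on_finite_codim`): the span of the eigenspaces of `J* J` for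
eigenvalues at least `λ` has dimension at least `n` if `λ < s_n(J)²`, so it meets that subspace, and
on it `‖J v‖² ≥ λ ‖v‖²`. Only this half of the characterization of singular values as approximation
numbers is needed, and compactness of `J` follows from the same subspaces
(`mem_expClass_and_expGauge_le`).

The subspaces come from the expansion of harmonic functions into homogeneous harmonic polynomials
on the balls `B(x, γ r)`. A homogeneous polynomial of degree `j` has on `B(x, r)` the norm
`γ ^ (-(j + d / 2))` times its norm on `B(x, γ r)`. Hence an `f` in `h²(B(x, γ r))` that is orthogonal
to the harmonic polynomials of degree less than `m` shrinks by the factor `γ ^ (-(m + d / 2))`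
(`norm_restrictL2_sq_le`), provided that the homogeneous harmonic polynomials of different degrees
are orthogonal on balls and span a dense subspace of `h²`. Both facts follow, without Weyl's lemma
and without surface integrals, from one identity (`setIntegral_sq_pow_mul`): testing `Δ f = 0` with
`P ψ(|x|²)`, for `P` homogeneous harmonic of degree `k`, shows that
`∫ f P |x| ^ (2 i) = β R ^ (2 i) / (β + i) ∫ f P` on the ball of radius `R`, with `β = k + d / 2`.
For polynomial `f` the factor depends on the degree of `P` and, by symmetry, on that of `f` in the
same way, which forces orthogonality (`inner_polyL2_eq_zero`). And if `f` is orthogonal to all `P`,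
then it is orthogonal to all `|x| ^ (2 i) P`, which span the polynomials
(`mem_fischerSpan_of_isHomogeneous`), so that `f = 0`
(`eq_zero_of_forall_inner_polyL2_eq_zero`).

There remains a count. A harmonic polynomial is determined by its Cauchy data on a hyperplane, which
bounds the dimension in degrees less than `m` by `harmonicCount (d - 1) m`
(`finrank_harmonicDegreeLT_le`), and by the arithmetic-geometric mean inequality
`(d - 1)! / 2` times the dimension in degrees at most `m` is at most `(m + (d - 1) / 2) ^ (d - 1)`.
If the index `n` is divided among the balls in proportion to `(log γ_k) ^ (-(d - 1))`, then the
restrictions to all balls decay at the common rate `c` (`exists_cutoff_degrees`).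
-/

/-! ### Operators that are small on subspaces of finite codimension -/

section SingularValues

variable {H₁ H₂ : Type*} [NormedAddCommGroup H₁] [InnerProductSpace ℂ H₁] [CompleteSpace H₁]
  [NormedAddCommGroup H₂] [InnerProductSpace ℂ H₂] [CompleteSpace H₂]

lemma isSymmetric_adjoint_comp_self (A : H₁ →L[ℂ] H₂) :
    ((ContinuousLinearMap.adjoint A ∘L A : H₁ →L[ℂ] H₁) : Module.End ℂ H₁).IsSymmetric := by
  intro x y
  simp [ContinuousLinearMap.adjoint_inner_left, ContinuousLinearMap.adjoint_inner_right]

lemma inner_adjoint_comp_self (A : H₁ →L[ℂ] H₂) (v : H₁) :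
    inner ℂ v ((ContinuousLinearMap.adjoint A ∘L A) v) = ((‖A v‖ ^ 2 : ℝ) : ℂ) := by
  simp [ContinuousLinearMap.adjoint_inner_right, inner_self_eq_norm_sq_to_K]

/-- The span of the eigenspaces of `A* A` for eigenvalues of modulus at least `r` is a subspace on
which `A` is bounded below by `√r`. -/
lemma mul_norm_sq_le_of_mem_iSup_maxGenEigenspace (A : H₁ →L[ℂ] H₂) (r : ℝ) {v : H₁}
    (hv : v ∈ ⨆ μ : {μ : ℂ // r ≤ ‖μ‖}, Module.End.maxGenEigenspace
      ((ContinuousLinearMap.adjoint A ∘L A : H₁ →L[ℂ] H₁) : Module.End ℂ H₁) (μ : ℂ)) :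
    r * ‖v‖ ^ 2 ≤ ‖A v‖ ^ 2 := by
  set T : H₁ →L[ℂ] H₁ := ContinuousLinearMap.adjoint A ∘L A with hTdef
  have hT := isSymmetric_adjoint_comp_self A
  rw [← hTdef] at hT
  simp_rw [hT.isFinitelySemisimple.maxGenEigenspace_eq_eigenspace] at hv
  obtain ⟨f, hf, rfl⟩ := (Submodule.mem_iSup_iff_exists_finsupp _ _).1 hv
  have hort := (hT.orthogonalFamily_eigenspaces).comp
    (Subtype.coe_injective (p := fun μ : ℂ => r ≤ ‖μ‖))
  have hTf : ∀ μ : {μ : ℂ // r ≤ ‖μ‖}, T (f μ) = (μ : ℂ) • f μ := fun μ =>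
    Module.End.mem_eigenspace_iff.1 (hf μ)
  have hnorm : ‖f.sum fun _ y => y‖ ^ 2 = ∑ μ ∈ f.support, ‖f μ‖ ^ 2 :=
    hort.norm_sum (fun μ => ⟨f μ, hf μ⟩) f.support
  have hTsum : T (f.sum fun _ y => y) = ∑ μ ∈ f.support, (μ : ℂ) • f μ := by
    simp [Finsupp.sum, map_sum, hTf]
  have hin : inner ℂ (f.sum fun _ y => y) (T (f.sum fun _ y => y)) =
      ∑ μ ∈ f.support, inner ℂ (f μ) ((μ : ℂ) • f μ) := by
    rw [hTsum]
    exact hort.inner_sum (fun μ => ⟨f μ, hf μ⟩)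
      (fun μ => ⟨(μ : ℂ) • f μ, Submodule.smul_mem _ _ (hf μ)⟩) f.support
  rw [hTdef, inner_adjoint_comp_self] at hin
  -- an eigenvalue of `A* A` that has a nonzero eigenvector is equal to its own modulus
  have hterm : ∀ μ ∈ f.support, inner ℂ (f μ) ((μ : ℂ) • f μ) =
      ((‖(μ : ℂ)‖ * ‖f μ‖ ^ 2 : ℝ) : ℂ) := by
    intro μ hμ
    have hne : f μ ≠ 0 := by simpa using hμ
    have h1 := inner_adjoint_comp_self A (f μ)
    rw [← hTdef, hTf μ, inner_smul_right, inner_self_eq_norm_sq_to_K] at h1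
    have hpos : (0 : ℝ) < ‖f μ‖ ^ 2 := by positivity
    have h2 : (μ : ℂ) = ((‖A (f μ)‖ ^ 2 / ‖f μ‖ ^ 2 : ℝ) : ℂ) := by
      rw [Complex.ofReal_div, ← h1]
      have : ((‖f μ‖ ^ 2 : ℝ) : ℂ) ≠ 0 := by exact_mod_cast hpos.ne'
      rw [eq_div_iff this]
      push_cast
      rfl
    have h3 : (‖(μ : ℂ)‖ : ℂ) = (μ : ℂ) := by
      rw [h2, Complex.norm_real, Real.norm_of_nonneg (by positivity)]
    rw [inner_smul_right, inner_self_eq_norm_sq_to_K, Complex.ofReal_mul, h3]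
    push_cast
    rfl
  rw [Finset.sum_congr rfl hterm, ← Complex.ofReal_sum] at hin
  rw [Complex.ofReal_injective hin, hnorm, Finset.mul_sum]
  exact Finset.sum_le_sum fun μ _ => mul_le_mul_of_nonneg_right μ.2 (by positivity)

/-- The easy half of the approximation number characterization: if `A` is bounded by `δ` on a
subspace of codimension less than `n`, then `s_n(A) ≤ δ`. -/
lemma singularValue_le_of_norm_le_on_finite_codim (A : H₁ →L[ℂ] H₂) (K : Submodule ℂ H₁)
    [FiniteDimensional ℂ (H₁ ⧸ K)] {n : ℕ} {δ : ℝ} (hδ : 0 ≤ δ)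
    (hn : Module.finrank ℂ (H₁ ⧸ K) < n) (hK : ∀ v ∈ K, ‖A v‖ ≤ δ * ‖v‖) :
    singularValue A n ≤ δ := by
  refine Real.sqrt_le_iff.2 ⟨hδ, Real.sSup_le ?_ (sq_nonneg δ)⟩
  rintro r ⟨hr, hrank⟩
  set W := ⨆ μ : {μ : ℂ // r ≤ ‖μ‖}, Module.End.maxGenEigenspace
      ((ContinuousLinearMap.adjoint A ∘L A : H₁ →L[ℂ] H₁) : Module.End ℂ H₁) (μ : ℂ) with hW
  obtain ⟨w, hw0, hwK⟩ : ∃ w : W, w ≠ 0 ∧ (w : H₁) ∈ K := by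
    by_contra! hcon
    have hinj : Function.Injective (K.mkQ ∘ₗ W.subtype) := by
      rw [← LinearMap.ker_eq_bot, LinearMap.ker_eq_bot']
      intro w hw
      by_contra hne
      exact hcon w hne ((Submodule.Quotient.mk_eq_zero K).1 hw)
    have h1 := hrank.trans (LinearMap.rank_le_of_injective _ hinj)
    rw [← Module.finrank_eq_rank ℂ (H₁ ⧸ K)] at h1
    exact absurd (Nat.cast_le.1 h1) (not_le.2 hn)
  have hlow := mul_norm_sq_le_of_mem_iSup_maxGenEigenspace A r w.2
  have hup := hK w hwK
  have hpos : 0 < ‖(w : H₁)‖ ^ 2 := by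
    have : (w : H₁) ≠ 0 := by simpa using hw0
    positivity
  refine le_of_mul_le_mul_right (hlow.trans ?_) hpos
  rw [← mul_pow]
  gcongr

/-- An operator that is arbitrarily small on subspaces of finite codimension is compact. -/
lemma isCompactOperator_of_norm_le_on_finite_codim (A : H₁ →L[ℂ] H₂)
    (h : ∀ ε : ℝ, 0 < ε → ∃ K : Submodule ℂ H₁, FiniteDimensional ℂ (H₁ ⧸ K) ∧
      ∀ v ∈ K, ‖A v‖ ≤ ε * ‖v‖) : IsCompactOperator A := by
  choose! K hfin hK using h
  have hu : ∀ n : ℕ, (0 : ℝ) < 1 / ((n : ℝ) + 1) := fun n => Nat.one_div_pos_of_nat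
  -- the subspaces are replaced by their closures, which have orthogonal projections
  set C : ℕ → Submodule ℂ H₁ := fun n => (K (1 / ((n : ℝ) + 1))).topologicalClosure with hC
  have hCc : ∀ n, IsClosed (C n : Set H₁) := fun n => Submodule.isClosed_topologicalClosure _
  have : ∀ n, CompleteSpace (C n) := fun n => (hCc n).completeSpace_coe
  have hCK : ∀ n, ∀ v ∈ C n, ‖A v‖ ≤ 1 / ((n : ℝ) + 1) * ‖v‖ := by
    intro n v hv
    have hcl : IsClosed {v : H₁ | ‖A v‖ ≤ 1 / ((n : ℝ) + 1) * ‖v‖} :=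
      isClosed_le (by fun_prop) (by fun_prop)
    exact closure_minimal (hK _ (hu n)) hcl hv
  have hfd : ∀ n, FiniteDimensional ℂ (C n)ᗮ := by
    intro n
    have := hfin _ (hu n)
    have hinj : Function.Injective ((K (1 / ((n : ℝ) + 1))).mkQ ∘ₗ (C n)ᗮ.subtype) := by
      rw [← LinearMap.ker_eq_bot, LinearMap.ker_eq_bot']
      intro w hw
      have h1 : (w : H₁) ∈ K (1 / ((n : ℝ) + 1)) := by simpa using hw
      have h2 : (w : H₁) ∈ C n := Submodule.le_topologicalClosure _ h1
      have h3 := Submodule.mem_orthogonal (C n) w |>.1 w.2 w h2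
      exact Subtype.ext (inner_self_eq_zero.1 h3)
    exact FiniteDimensional.of_injective _ hinj
  -- `A` composed with the projection onto the orthogonal complement has finite rank
  have hcomp : ∀ n, IsCompactOperator (A ∘L (C n)ᗮ.starProjection) := by
    intro n
    have := hfd n
    have : LocallyCompactSpace (C n)ᗮ := by
      have := FiniteDimensional.proper ℂ (C n)ᗮ
      infer_instance
    have : IsCompactOperator ((A ∘L (C n)ᗮ.subtypeL) : (C n)ᗮ →L[ℂ] H₂) :=
      isCompactOperator_of_locallyCompactSpace_rng _
    exact this.comp_clm (C n)ᗮ.orthogonalProjectionOnto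
  refine isCompactOperator_of_tendsto (F := fun n => A ∘L (C n)ᗮ.starProjection) (l := atTop) ?_
    (Eventually.of_forall hcomp)
  rw [tendsto_iff_norm_sub_tendsto_zero]
  refine squeeze_zero (fun _ => norm_nonneg _) (fun n => ?_) tendsto_one_div_add_atTop_nhds_zero_nat
  refine ContinuousLinearMap.opNorm_le_bound _ (hu n).le fun v => ?_
  have hv : (A ∘L (C n)ᗮ.starProjection - A) v = -A ((C n).starProjection v) := by
    have := (C n).starProjection_add_starProjection_orthogonal v
    conv_lhs => rw [sub_apply, ContinuousLinearMap.comp_apply]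
    nth_rewrite 2 [← this]
    rw [map_add]
    abel
  rw [hv, norm_neg]
  refine (hCK n _ (Submodule.starProjection_apply_mem _ _)).trans ?_
  gcongr
  exact Submodule.norm_starProjection_apply_le _ _

/-- An operator that has norm at most `C exp(-a n ^ α)` on a subspace of codimension less than `n`,
for every `n ≥ 1`, is in the exponential class `E(a, α)`, with gauge at most `C`. -/
lemma mem_expClass_and_expGauge_le (A : H₁ →L[ℂ] H₂) {C a α : ℝ} (hC : 0 ≤ C) (ha : 0 < a)
    (hα : 0 < α) (h : ∀ n : ℕ, 1 ≤ n → ∃ K : Submodule ℂ H₁, FiniteDimensional ℂ (H₁ ⧸ K) ∧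
      Module.finrank ℂ (H₁ ⧸ K) < n ∧
      ∀ v ∈ K, ‖A v‖ ≤ C * Real.exp (-(a * (n : ℝ) ^ α)) * ‖v‖) :
    A ∈ expClass H₁ H₂ a α ∧ expGauge a α A ≤ C := by
  have hsv : ∀ n : ℕ+, singularValue A n * Real.exp (a * (n : ℝ) ^ α) ≤ C := by
    intro n
    obtain ⟨K, hK1, hK2, hK3⟩ := h n n.2
    have := singularValue_le_of_norm_le_on_finite_codim A K (by positivity) hK2 hK3
    refine (mul_le_mul_of_nonneg_right this (Real.exp_pos _).le).trans_eq ?_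
    rw [mul_assoc, ← Real.exp_add, neg_add_cancel, Real.exp_zero, mul_one]
  refine ⟨⟨isCompactOperator_of_norm_le_on_finite_codim A fun ε hε => ?_, C, ?_⟩, ciSup_le hsv⟩
  · have hlim : Tendsto (fun n : ℕ => C * Real.exp (-(a * (n : ℝ) ^ α))) atTop (𝓝 (C * 0)) := by
      refine (Real.tendsto_exp_neg_atTop_nhds_zero.comp ?_).const_mul _
      exact ((tendsto_rpow_atTop hα).comp tendsto_natCast_atTop_atTop).const_mul_atTop ha
    rw [mul_zero] at hlim
    obtain ⟨n, hn1, hn⟩ := ((hlim.eventually_le_const hε).and (eventually_ge_atTop 1)).exists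
    obtain ⟨K, hK1, -, hK3⟩ := h n hn
    exact ⟨K, hK1, fun v hv => (hK3 v hv).trans (by gcongr)⟩
  · rintro _ ⟨n, rfl⟩
    exact hsv n

lemma finrank_quotient_ker_pi_le {𝕜 E ι : Type*} [Field 𝕜] [AddCommGroup E] [Module 𝕜 E]
    [Fintype ι] {U : ι → Type*} [∀ k, AddCommGroup (U k)] [∀ k, Module 𝕜 (U k)]
    [∀ k, FiniteDimensional 𝕜 (U k)] (L : E →ₗ[𝕜] ∀ k, U k) :
    FiniteDimensional 𝕜 (E ⧸ LinearMap.ker L) ∧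
      Module.finrank 𝕜 (E ⧸ LinearMap.ker L) ≤ ∑ k, Module.finrank 𝕜 (U k) := by
  refine ⟨Module.Finite.equiv L.quotKerEquivRange.symm, ?_⟩
  rw [L.quotKerEquivRange.finrank_eq, ← Module.finrank_pi_fintype]
  exact Submodule.finrank_le _

end SingularValues

/-! ### Distribution of the index over the balls -/

section Counting

/-- The dimension of the space of harmonic polynomials in `e + 1` variables of degree less than `m`,
for `e ≥ 1`. -/
def harmonicCount (e m : ℕ) : ℕ := (m + e - 1).choose e + (m + e - 2).choose e

lemma harmonicCount_zero {e : ℕ} (he : 1 ≤ e) : harmonicCount e 0 = 0 := by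
  unfold harmonicCount
  rw [Nat.choose_eq_zero_of_lt (by omega), Nat.choose_eq_zero_of_lt (by omega)]

lemma succ_le_harmonicCount {e : ℕ} (he : 1 ≤ e) (m : ℕ) : m + 1 ≤ harmonicCount e (m + 1) := by
  unfold harmonicCount
  refine le_add_right ?_
  obtain ⟨k, rfl⟩ := Nat.exists_eq_add_of_le' he
  have h : m + 1 + (k + 1) - 1 = m + k + 1 := by omega
  rw [h]
  clear h
  induction m with
  | zero => simp
  | succ m ih =>
    have h2 : m + 1 + k + 1 = (m + k + 1) + 1 := by omega
    rw [h2, Nat.choose_succ_succ]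
    have : 1 ≤ (m + k + 1).choose k := Nat.choose_pos (by omega)
    simp only [Nat.succ_eq_add_one]
    omega

/-- The arithmetic-geometric mean inequality for `(m + 1) ⋯ (m + k)`, whose factors have the mean
`m + (k + 1) / 2`: the `i`-th factors from both ends have this mean, too. -/
lemma prod_range_add_le_pow (m k : ℕ) :
    ∏ i ∈ Finset.range k, ((m : ℝ) + 1 + i) ≤ (m + (k + 1) / 2) ^ k := by
  have h0 : (0 : ℝ) ≤ ∏ i ∈ Finset.range k, ((m : ℝ) + 1 + i) :=
    Finset.prod_nonneg fun i _ => by positivity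
  refine le_of_sq_le_sq ?_ (by positivity)
  have hrefl : ∏ i ∈ Finset.range k, ((m : ℝ) + 1 + i) =
      ∏ i ∈ Finset.range k, ((m : ℝ) + k - i) := by
    rw [← Finset.prod_range_reflect]
    refine Finset.prod_congr rfl fun i hi => ?_
    have hi : i < k := Finset.mem_range.1 hi
    have : ((k - 1 - i : ℕ) : ℝ) = k - 1 - i := by
      rw [Nat.cast_sub (by omega), Nat.cast_sub (by omega)]; simp
    rw [this]; ring
  rw [sq]
  nth_rewrite 2 [hrefl]
  rw [← Finset.prod_mul_distrib, ← pow_mul, mul_comm k 2, pow_mul, ← Finset.card_range k,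
    ← Finset.prod_const, Finset.card_range]
  refine Finset.prod_le_prod (fun i hi => ?_) fun i hi => ?_
  · have hi : (i : ℝ) < k := by exact_mod_cast Finset.mem_range.1 hi
    have : (0 : ℝ) ≤ m := m.cast_nonneg
    exact mul_nonneg (by positivity) (by linarith)
  · nlinarith [sq_nonneg (((k : ℝ) - 1) / 2 - i)]

/-- The left-hand side is `(m + 1) ⋯ (m + e - 1) (m + e / 2)`, a product of `e` factors with mean
`m + e / 2`. -/
lemma factorial_mul_harmonicCount_le {e : ℕ} (he : 1 ≤ e) (m : ℕ) :
    (e.factorial : ℝ) / 2 * harmonicCount e (m + 1) ≤ (m + e / 2) ^ e := by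
  obtain ⟨k, rfl⟩ := Nat.exists_eq_add_of_le' he
  set Q : ℝ := ∏ i ∈ Finset.range k, ((m : ℝ) + 1 + i) with hQ
  have h1 : ((k + 1).factorial : ℝ) * ((m + k + 1).choose (k + 1) : ℕ) = Q * (m + k + 1) := by
    have := Nat.ascFactorial_eq_factorial_mul_choose m (k + 1)
    rw [Nat.ascFactorial_eq_prod_range, Finset.prod_range_succ] at this
    have h := congrArg (Nat.cast : ℕ → ℝ) this
    push_cast at h
    rw [hQ, add_assoc (m : ℕ) k 1, ← h]
    ring
  have h2 : ((k + 1).factorial : ℝ) * ((m + k).choose (k + 1) : ℕ) = Q * m := by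
    have := Nat.ascFactorial_eq_factorial_mul_choose' m (k + 1)
    rw [Nat.ascFactorial_eq_prod_range, Finset.prod_range_succ'] at this
    have h := congrArg (Nat.cast : ℕ → ℝ) this
    rw [← add_assoc, Nat.add_sub_cancel] at h
    push_cast at h
    rw [← h, hQ, add_zero]
    congr 1
    exact Finset.prod_congr rfl fun i _ => by ring
  have h3 : harmonicCount (k + 1) (m + 1) = (m + k + 1).choose (k + 1) + (m + k).choose (k + 1) := by
    unfold harmonicCount
    congr 2 <;> omega
  rw [h3]
  push_cast
  have h4 : ((k + 1).factorial : ℝ) / 2 * (((m + k + 1).choose (k + 1) : ℕ) +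
      ((m + k).choose (k + 1) : ℕ)) = Q * (m + (k + 1) / 2) := by
    linear_combination (h1 + h2) / 2
  rw [h4, pow_succ]
  gcongr
  exact prod_range_add_le_pow m k

lemma exists_harmonicCount_lt_le {e : ℕ} (he : 1 ≤ e) {n : ℕ} (hn : 1 ≤ n) :
    ∃ m, harmonicCount e m < n ∧ n ≤ harmonicCount e (m + 1) := by
  classical
  have hex : ∃ m, n ≤ harmonicCount e (m + 1) :=
    ⟨n, (Nat.le_succ n).trans (succ_le_harmonicCount he n)⟩
  refine ⟨Nat.find hex, ?_, Nat.find_spec hex⟩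
  rcases h : Nat.find hex with _ | k
  · rw [harmonicCount_zero he]; omega
  · exact not_le.1 (Nat.find_min hex (by omega : k < Nat.find hex))

/-- The index `n` is distributed over the balls of a relative cover in the proportions
`|Γ_k|^{-e} / ∑_j |Γ_j|^{-e}`: the degree `m k` at which the expansion on the `k`-th ball is cut off
leaves less than `n` coefficients in total, and the remainders all have the required size. -/
lemma exists_cutoff_degrees {e N : ℕ} (he : 1 ≤ e) (Γ : Fin N → ℝ) (hΓ : ∀ k, 0 < Γ k) (hN : 1 ≤ N)
    {n : ℕ} (hn : 1 ≤ n) :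
    ∃ m : Fin N → ℕ, ∑ k, harmonicCount e (m k) < n ∧
      ∀ k, Real.exp (-((m k + ((e : ℝ) + 1) / 2) * Γ k)) ≤ Real.exp (-(effMin Γ) / 2) *
        Real.exp (-((((e.factorial : ℝ) / 2) ^ (1 / (e : ℝ)) * effNorm e Γ) *
          (n : ℝ) ^ (1 / (e : ℝ)))) := by
  have : Nonempty (Fin N) := ⟨⟨0, hN⟩⟩
  have he0 : (0 : ℝ) < e := by exact_mod_cast he
  have hn0 : (0 : ℝ) < n := by exact_mod_cast hn
  set S : ℝ := ∑ j, (|Γ j| ^ e)⁻¹ with hS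
  have hpos : ∀ k, 0 < (|Γ k| ^ e)⁻¹ := fun k => by have := hΓ k; positivity
  have hS0 : 0 < S := Finset.sum_pos (fun k _ => hpos k) Finset.univ_nonempty
  set θ : Fin N → ℝ := fun k => (|Γ k| ^ e)⁻¹ / S with hθ
  have hθ0 : ∀ k, 0 < θ k := fun k => div_pos (hpos k) hS0
  have hθ1 : ∑ k, θ k = 1 := by
    rw [← Finset.sum_div, ← hS, div_self hS0.ne']
  have hceil : ∀ k, 1 ≤ ⌈θ k * n⌉₊ := fun k =>
    Nat.one_le_iff_ne_zero.2 (Nat.ceil_pos.2 (mul_pos (hθ0 k) hn0)).ne'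
  choose m hm1 hm2 using fun k => exists_harmonicCount_lt_le he (hceil k)
  refine ⟨m, ?_, fun k => ?_⟩
  · have hlt : ∀ k, (harmonicCount e (m k) : ℝ) < θ k * n := by
      intro k
      exact Nat.lt_ceil.1 (hm1 k)
    have : ∑ k, (harmonicCount e (m k) : ℝ) < ∑ k, θ k * n :=
      Finset.sum_lt_sum_of_nonempty Finset.univ_nonempty fun k _ => hlt k
    rw [← Finset.sum_mul, hθ1, one_mul] at this
    exact_mod_cast this
  · have hk := hΓ k
    have h1 : (e.factorial : ℝ) / 2 * (θ k * n) ≤ (m k + e / 2) ^ e := by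
      refine le_trans ?_ (factorial_mul_harmonicCount_le he (m k))
      refine mul_le_mul_of_nonneg_left ?_ (by positivity)
      exact (Nat.le_ceil _).trans (by exact_mod_cast hm2 k)
    have hf : (0 : ℝ) < (e.factorial : ℝ) / 2 := by positivity
    have h2 : ((e.factorial : ℝ) / 2 * (θ k * n)) ^ (1 / (e : ℝ)) ≤ m k + e / 2 := by
      have := Real.rpow_le_rpow (mul_pos hf (mul_pos (hθ0 k) hn0)).le h1 (z := 1 / (e : ℝ))
        (by positivity)
      refine this.trans_eq ?_
      rw [one_div, Real.pow_rpow_inv_natCast (by positivity) (by omega)]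
    -- the proportions `θ` are the ones that make the rates on all balls equal
    have h3 : (θ k) ^ (1 / (e : ℝ)) * Γ k = effNorm e Γ := by
      rw [hθ, effNorm, ← hS, Real.div_rpow (hpos k).le hS0.le, Real.rpow_neg hS0.le,
        Real.inv_rpow (by positivity), one_div, Real.pow_rpow_inv_natCast (by positivity) (by omega),
        abs_of_pos hk]
      field_simp
    rw [Real.mul_rpow hf.le (mul_pos (hθ0 k) hn0).le, Real.mul_rpow (hθ0 k).le hn0.le] at h2
    have h4 : effMin Γ ≤ Γ k := by
      have := ciInf_le (f := fun j => |Γ j|) (Set.finite_range _).bddBelow k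
      rwa [abs_of_pos hk] at this
    rw [← Real.exp_add]
    refine Real.exp_le_exp.2 ?_
    have h5 := mul_le_mul_of_nonneg_right h2 hk.le
    rw [← h3]
    nlinarith [h5, h4]

end Counting

/-! ### Harmonic polynomials -/

section HarmonicPolynomials

open MvPolynomial

variable {d : ℕ}

/-- The formal Laplacian `∑ ∂ᵢ²` on polynomials. -/
noncomputable def polyLaplacian (d : ℕ) : MvPolynomial (Fin d) ℂ →ₗ[ℂ] MvPolynomial (Fin d) ℂ :=
  ∑ i, (pderiv i).toLinearMap ∘ₗ (pderiv i).toLinearMap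

lemma polyLaplacian_apply (P : MvPolynomial (Fin d) ℂ) :
    polyLaplacian d P = ∑ i, pderiv i (pderiv i P) := by
  simp [polyLaplacian]

/-- The harmonic polynomials that are homogeneous of degree `j`. -/
noncomputable def harmonicHomogeneous (d j : ℕ) : Submodule ℂ (MvPolynomial (Fin d) ℂ) :=
  homogeneousSubmodule (Fin d) ℂ j ⊓ LinearMap.ker (polyLaplacian d)

/-- The harmonic polynomials of degree less than `m`. -/
noncomputable def harmonicDegreeLT (d m : ℕ) : Submodule ℂ (MvPolynomial (Fin d) ℂ) :=
  restrictSupport ℂ {s : Fin d →₀ ℕ | s.degree < m} ⊓ LinearMap.ker (polyLaplacian d)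

lemma mem_harmonicHomogeneous {j : ℕ} {P : MvPolynomial (Fin d) ℂ} :
    P ∈ harmonicHomogeneous d j ↔ P.IsHomogeneous j ∧ polyLaplacian d P = 0 := by
  simp [harmonicHomogeneous]

lemma mem_harmonicDegreeLT {m : ℕ} {P : MvPolynomial (Fin d) ℂ} :
    P ∈ harmonicDegreeLT d m ↔
      (∀ s, coeff s P ≠ 0 → s.degree < m) ∧ polyLaplacian d P = 0 := by
  simp [harmonicDegreeLT, mem_restrictSupport_iff, Set.subset_def]

lemma harmonicHomogeneous_le_harmonicDegreeLT {j m : ℕ} (h : j < m) :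
    harmonicHomogeneous d j ≤ harmonicDegreeLT d m := by
  intro P hP
  rw [mem_harmonicHomogeneous] at hP
  refine mem_harmonicDegreeLT.2 ⟨fun s hs => ?_, hP.2⟩
  have := hP.1 hs
  rw [show (1 : Fin d → ℕ) = fun _ => 1 from rfl, ← Finsupp.degree_eq_weight_one] at this
  exact this ▸ h

/-- The exponents `s` of degree less than `m` with `s 0 ≤ 1`. The coefficients of a polynomial with
these exponents are its Cauchy data on the hyperplane `x₀ = 0`. -/
noncomputable def cauchyExponents (e m : ℕ) : Finset (Fin (e + 1) →₀ ℕ) :=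
  ((Finset.range m).biUnion fun j => Finset.univ.finsuppAntidiag j).filter fun s => s 0 ≤ 1

lemma mem_cauchyExponents {e m : ℕ} {s : Fin (e + 1) →₀ ℕ} :
    s ∈ cauchyExponents e m ↔ s.degree < m ∧ s 0 ≤ 1 := by
  simp [cauchyExponents, Finset.mem_finsuppAntidiag, Finsupp.degree_eq_sum]

/-- Replacing the zeroth exponent by the defect of the total degree turns the exponents with
`s 0 = a` into the exponents of total degree `m - 1 - a`. -/
lemma card_cauchyExponents_filter_le {e m : ℕ} (a : ℕ) :
    ((cauchyExponents e m).filter fun s => s 0 = a).card ≤ (m + e - 1 - a).choose e := by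
  classical
  by_cases hm : m < a + 1
  · rw [Finset.card_eq_zero.2]
    · exact Nat.zero_le _
    · refine Finset.filter_eq_empty_iff.2 fun s hs h => ?_
      have h1 := (mem_cauchyExponents.1 hs).1
      rw [Finsupp.degree_eq_sum, Fin.sum_univ_succ] at h1
      omega
  have hcard : (Finset.univ.finsuppAntidiag (m - 1 - a) : Finset (Fin (e + 1) →₀ ℕ)).card =
      (m + e - 1 - a).choose e := by
    rw [Finset.card_finsuppAntidiag_nat_eq_choose, Finset.card_univ, Fintype.card_fin,
      ← Nat.choose_symm_of_eq_add (a := m - 1 - a) (b := e)]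
    · congr 1; omega
    · omega
  rw [← hcard]
  refine Finset.card_le_card_of_injOn (fun s => s.update 0 (m - 1 - s.degree)) ?_ ?_
  · intro s hs
    have hs := Finset.mem_filter.1 (Finset.mem_coe.1 hs)
    have h1 := (mem_cauchyExponents.1 hs.1).1
    have h2 := hs.2
    simp only [Finset.mem_coe, Finset.mem_finsuppAntidiag, Finset.subset_univ, and_true]
    rw [Fin.sum_univ_succ]
    have h3 : ∀ i : Fin e, (s.update 0 (m - 1 - s.degree)) i.succ = s i.succ := fun i => by
      simp [Finsupp.update, Function.update]
    simp only [h3]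
    rw [Finsupp.degree_eq_sum, Fin.sum_univ_succ] at h1
    rw [Finsupp.degree_eq_sum, Fin.sum_univ_succ]
    simp
    omega
  · intro s hs t ht hst
    have hs := (Finset.mem_filter.1 (Finset.mem_coe.1 hs)).2
    have ht := (Finset.mem_filter.1 (Finset.mem_coe.1 ht)).2
    ext i
    by_cases hi : i = 0
    · rw [hi, hs, ht]
    · have := DFunLike.congr_fun hst i
      simpa [Finsupp.update, Function.update, hi] using this

lemma card_cauchyExponents_le (e m : ℕ) :
    (cauchyExponents e m).card ≤ harmonicCount e m := by
  classical
  have hsub : cauchyExponents e m ⊆ ((cauchyExponents e m).filter fun s => s 0 = 0) ∪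
      ((cauchyExponents e m).filter fun s => s 0 = 1) := by
    intro s hs
    have := (mem_cauchyExponents.1 hs).2
    simp only [Finset.mem_union, Finset.mem_filter, hs, true_and]
    omega
  refine (Finset.card_le_card hsub).trans ((Finset.card_union_le _ _).trans ?_)
  have h0 := card_cauchyExponents_filter_le (e := e) (m := m) 0
  have h1 := card_cauchyExponents_filter_le (e := e) (m := m) 1
  unfold harmonicCount
  have : m + e - 2 = m + e - 1 - 1 := by omega
  rw [this]
  exact add_le_add h0 h1

lemma coeff_polyLaplacian (P : MvPolynomial (Fin d) ℂ) (s : Fin d →₀ ℕ) :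
    coeff s (polyLaplacian d P) = ∑ i, coeff (s + Finsupp.single i 2) P * ((s i + 2) * (s i + 1)) := by
  rw [polyLaplacian_apply, coeff_sum]
  refine Finset.sum_congr rfl fun i _ => ?_
  rw [coeff_pderiv, coeff_pderiv, add_assoc, ← Finsupp.single_add]
  simp
  ring

/-- A harmonic polynomial is determined by its Cauchy data on the hyperplane `x₀ = 0`, that is, by
its coefficients with `x₀`-exponent at most one. -/
lemma eq_zero_of_coeff_cauchyExponents {e m : ℕ} {P : MvPolynomial (Fin (e + 1)) ℂ}
    (hP : P ∈ harmonicDegreeLT (e + 1) m) (h : ∀ s ∈ cauchyExponents e m, coeff s P = 0) :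
    P = 0 := by
  obtain ⟨hdeg, hlap⟩ := mem_harmonicDegreeLT.1 hP
  have key : ∀ k : ℕ, ∀ s : Fin (e + 1) →₀ ℕ, s 0 = k → coeff s P = 0 := by
    intro k
    induction k using Nat.strong_induction_on with
    | _ k ih =>
      intro s hs
      by_contra hne
      by_cases hk : k ≤ 1
      · exact hne (h s (mem_cauchyExponents.2 ⟨hdeg s hne, hs ▸ hk⟩))
      set t : Fin (e + 1) →₀ ℕ := s - Finsupp.single 0 2 with ht
      have hst : t + Finsupp.single 0 2 = s := by
        refine tsub_add_cancel_of_le ?_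
        rw [Finsupp.single_le_iff]
        omega
      have ht0 : t 0 + 2 = k := by rw [← hs, ← hst]; simp
      have hc := coeff_polyLaplacian P t
      rw [hlap, coeff_zero, Finset.sum_eq_single 0] at hc
      · rw [hst] at hc
        rcases mul_eq_zero.1 hc.symm with hc | hc
        · exact hne hc
        · have : ((t 0 : ℂ) + 2) * (t 0 + 1) = (((t 0 + 2) * (t 0 + 1) : ℕ) : ℂ) := by push_cast; ring
          rw [this] at hc
          exact absurd (Nat.cast_eq_zero.1 hc) (by positivity)
      · intro i _ hi
        rw [ih (t 0) (by omega) _ (by simp [hi]), zero_mul]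
      · simp
  ext s
  rw [key _ s rfl, coeff_zero]

/-- Evaluation of the Cauchy data, as a linear map. -/
noncomputable def cauchyData (e m : ℕ) :
    harmonicDegreeLT (e + 1) m →ₗ[ℂ] (cauchyExponents e m → ℂ) :=
  LinearMap.pi fun s => lcoeff ℂ (s : Fin (e + 1) →₀ ℕ) ∘ₗ (harmonicDegreeLT (e + 1) m).subtype

lemma injective_cauchyData (e m : ℕ) : Function.Injective (cauchyData e m) := by
  rw [← LinearMap.ker_eq_bot, LinearMap.ker_eq_bot']
  intro P hP
  refine Subtype.ext (eq_zero_of_coeff_cauchyExponents P.2 fun s hs => ?_)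
  exact congrFun hP ⟨s, hs⟩

instance finiteDimensional_harmonicDegreeLT (e m : ℕ) :
    FiniteDimensional ℂ (harmonicDegreeLT (e + 1) m) :=
  FiniteDimensional.of_injective _ (injective_cauchyData e m)

lemma finrank_harmonicDegreeLT_le (e m : ℕ) :
    Module.finrank ℂ (harmonicDegreeLT (e + 1) m) ≤ harmonicCount e m := by
  refine (LinearMap.finrank_le_finrank_of_injective (injective_cauchyData e m)).trans ?_
  rw [Module.finrank_fintype_fun_eq_card, Fintype.card_coe]
  exact card_cauchyExponents_le e m

/-- The polynomial `∑ xᵢ²`. -/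
noncomputable def sqNormPoly (d : ℕ) : MvPolynomial (Fin d) ℂ := ∑ i, X i ^ 2

lemma isHomogeneous_sqNormPoly : (sqNormPoly d).IsHomogeneous 2 :=
  IsHomogeneous.sum _ _ _ fun i _ => isHomogeneous_X_pow i 2

lemma pderiv_sqNormPoly (i : Fin d) : pderiv i (sqNormPoly d) = 2 * X i := by
  rw [sqNormPoly, map_sum, Finset.sum_eq_single i]
  · simp
  · intro j _ hj
    simp [pderiv_X_of_ne hj]
  · simp

lemma polyLaplacian_sqNormPoly_mul {k : ℕ} {F : MvPolynomial (Fin d) ℂ} (hF : F.IsHomogeneous k) :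
    polyLaplacian d (sqNormPoly d * F) =
      C (2 * d + 4 * k : ℂ) * F + sqNormPoly d * polyLaplacian d F := by
  have h : ∀ i, pderiv i (pderiv i (sqNormPoly d * F)) =
      2 * F + 4 * (X i * pderiv i F) + sqNormPoly d * pderiv i (pderiv i F) := by
    intro i
    simp only [pderiv_mul, map_add, pderiv_sqNormPoly, pderiv_X_self]
    have : pderiv i (2 : MvPolynomial (Fin d) ℂ) = 0 := pderiv_C (a := (2 : ℂ))
    rw [this]
    ring
  simp only [polyLaplacian_apply, h, Finset.sum_add_distrib, ← Finset.mul_sum,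
    hF.sum_X_mul_pderiv, Finset.sum_const, Finset.card_univ, Fintype.card_fin, nsmul_eq_mul]
  simp only [map_add, map_mul, map_natCast, map_ofNat]
  ring

lemma polyLaplacian_sqNormPoly_pow_mul {j : ℕ} {h : MvPolynomial (Fin d) ℂ}
    (hh : h ∈ harmonicHomogeneous d j) (a : ℕ) :
    polyLaplacian d (sqNormPoly d ^ (a + 1) * h) =
      C (2 * (a + 1) * (2 * a + 2 * j + d) : ℂ) * (sqNormPoly d ^ a * h) := by
  obtain ⟨hhom, hlap⟩ := mem_harmonicHomogeneous.1 hh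
  induction a with
  | zero =>
    rw [zero_add, pow_one, polyLaplacian_sqNormPoly_mul hhom, hlap]
    simp only [map_add, map_mul, map_natCast, map_ofNat, map_one, Nat.cast_zero, map_zero]
    ring
  | succ a ih =>
    have hF : (sqNormPoly d ^ (a + 1) * h).IsHomogeneous (2 * (a + 1) + j) :=
      (isHomogeneous_sqNormPoly.pow (a + 1)).mul hhom
    rw [pow_succ', mul_assoc, polyLaplacian_sqNormPoly_mul hF, ih]
    push_cast
    simp only [map_add, map_mul, map_natCast, map_ofNat, map_one]
    ring

/-- The span of the products, of total degree `n`, of a power of `|x|²` and a homogeneous harmonic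
polynomial. -/
noncomputable def fischerSpan (d n : ℕ) : Submodule ℂ (MvPolynomial (Fin d) ℂ) :=
  Submodule.span ℂ {P | ∃ a j : ℕ, ∃ h ∈ harmonicHomogeneous d j, 2 * a + j = n ∧
    P = sqNormPoly d ^ a * h}

lemma fischerSpan_le_homogeneousSubmodule (n : ℕ) :
    fischerSpan d n ≤ homogeneousSubmodule (Fin d) ℂ n := by
  refine Submodule.span_le.2 ?_
  rintro _ ⟨a, j, h, hh, rfl, rfl⟩
  exact (isHomogeneous_sqNormPoly.pow a).mul (mem_harmonicHomogeneous.1 hh).1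

lemma exists_polyLaplacian_eq_of_mem_fischerSpan (hd : 1 ≤ d) {n : ℕ}
    {q : MvPolynomial (Fin d) ℂ} (hq : q ∈ fischerSpan d n) :
    ∃ Q ∈ fischerSpan d (n + 2), polyLaplacian d Q = q := by
  suffices fischerSpan d n ≤ (fischerSpan d (n + 2)).map (polyLaplacian d) from this hq
  refine Submodule.span_le.2 ?_
  rintro _ ⟨a, j, h, hh, rfl, rfl⟩
  have hc : (2 * (a + 1) * (2 * a + 2 * j + d) : ℂ) ≠ 0 := by
    have : (2 * (a + 1) * (2 * a + 2 * j + d) : ℂ) =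
      ((2 * (a + 1) * (2 * a + 2 * j + d) : ℕ) : ℂ) := by push_cast; ring
    rw [this]
    exact_mod_cast (by positivity : 2 * (a + 1) * (2 * a + 2 * j + d) ≠ 0)
  refine ⟨(2 * (a + 1) * (2 * a + 2 * j + d) : ℂ)⁻¹ • (sqNormPoly d ^ (a + 1) * h),
    Submodule.smul_mem _ _ (Submodule.subset_span ⟨a + 1, j, h, hh, by ring, rfl⟩), ?_⟩
  rw [map_smul, polyLaplacian_sqNormPoly_pow_mul hh, C_mul', smul_smul, inv_mul_cancel₀ hc, one_smul]

/-- Every homogeneous polynomial is a sum of products of powers of `|x|²` and homogeneous harmonic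
polynomials. Since `Δ` maps `|x|²` times the span in degree `n` onto that span, a polynomial of
degree `n + 2` can be made harmonic by subtracting an element of the span. -/
lemma mem_fischerSpan_of_isHomogeneous (hd : 1 ≤ d) (n : ℕ) {P : MvPolynomial (Fin d) ℂ}
    (hP : P.IsHomogeneous n) : P ∈ fischerSpan d n := by
  induction n using Nat.strong_induction_on generalizing P with
  | _ n ih =>
    have hharm : ∀ H : MvPolynomial (Fin d) ℂ, H.IsHomogeneous n → polyLaplacian d H = 0 →
        H ∈ fischerSpan d n := fun H h1 h2 =>
      Submodule.subset_span ⟨0, n, H, mem_harmonicHomogeneous.2 ⟨h1, h2⟩, by ring, by simp⟩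
    have hconst : ∀ H : MvPolynomial (Fin d) ℂ, H.IsHomogeneous 0 → ∀ i, pderiv i H = 0 := by
      intro H hH i
      rw [totalDegree_eq_zero_iff_eq_C.1 ((totalDegree_zero_iff_isHomogeneous _).2 hH), pderiv_C]
    rcases n with _ | _ | n
    · refine hharm P hP ?_
      simp [polyLaplacian_apply, hconst P hP]
    · refine hharm P hP ?_
      rw [polyLaplacian_apply]
      exact Finset.sum_eq_zero fun i _ => hconst _ hP.pderiv i
    · have hlap : (polyLaplacian d P).IsHomogeneous n := by
        rw [polyLaplacian_apply]
        exact IsHomogeneous.sum _ _ _ fun i _ => hP.pderiv.pderiv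
      obtain ⟨Q, hQ, hQP⟩ := exists_polyLaplacian_eq_of_mem_fischerSpan hd (ih n (by omega) hlap)
      have h1 : P - Q ∈ fischerSpan d (n + 2) := by
        refine hharm _ ?_ (by rw [map_sub, hQP, sub_self])
        exact Submodule.sub_mem (homogeneousSubmodule (Fin d) ℂ (n + 2)) hP
          (fischerSpan_le_homogeneousSubmodule _ hQ)
      simpa using Submodule.add_mem _ h1 hQ

end HarmonicPolynomials

/-! ### The Laplacian of a polynomial times a radial function -/

section PolynomialFunctions

open MvPolynomial

variable {d : ℕ}

/-- The function `y ↦ P (y - x₀)` on `ℝᵈ`. -/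
noncomputable def polyAt (x₀ : EuclideanSpace ℝ (Fin d)) (P : MvPolynomial (Fin d) ℂ) :
    EuclideanSpace ℝ (Fin d) → ℂ :=
  fun y => eval (fun i => ((y i - x₀ i : ℝ) : ℂ)) P

variable (x₀ : EuclideanSpace ℝ (Fin d))

lemma contDiff_polyAt (P : MvPolynomial (Fin d) ℂ) {n : WithTop ℕ∞} :
    ContDiff ℝ n (polyAt x₀ P) := by
  induction P using MvPolynomial.induction_on with
  | C a =>
    have : polyAt x₀ (C a) = fun _ => a := by ext; simp [polyAt]
    exact this ▸ contDiff_const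
  | add p q hp hq =>
    have : polyAt x₀ (p + q) = fun y => polyAt x₀ p y + polyAt x₀ q y := by ext; simp [polyAt]
    exact this ▸ hp.add hq
  | mul_X p i hp =>
    have h1 : ContDiff ℝ n fun y : EuclideanSpace ℝ (Fin d) => ((y i - x₀ i : ℝ) : ℂ) :=
      Complex.ofRealCLM.contDiff.comp
        ((EuclideanSpace.proj i : EuclideanSpace ℝ (Fin d) →L[ℝ] ℝ).contDiff.sub contDiff_const)
    have : polyAt x₀ (p * X i) = fun y => polyAt x₀ p y * ((y i - x₀ i : ℝ) : ℂ) := by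
      ext; simp [polyAt]
    exact this ▸ hp.mul h1

lemma continuous_polyAt (P : MvPolynomial (Fin d) ℂ) : Continuous (polyAt x₀ P) :=
  (contDiff_polyAt x₀ P (n := 0)).continuous

lemma differentiable_polyAt (P : MvPolynomial (Fin d) ℂ) : Differentiable ℝ (polyAt x₀ P) :=
  (contDiff_polyAt x₀ P (n := 1)).differentiable one_ne_zero

lemma fderiv_polyAt (P : MvPolynomial (Fin d) ℂ) (y : EuclideanSpace ℝ (Fin d)) (i : Fin d) :
    fderiv ℝ (polyAt x₀ P) y (EuclideanSpace.single i 1) = polyAt x₀ (pderiv i P) y := by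
  induction P using MvPolynomial.induction_on with
  | C a =>
    have : polyAt x₀ (C a) = fun _ => a := by ext; simp [polyAt]
    rw [this, pderiv_C]
    simp [polyAt]
  | add p q hp hq =>
    have : polyAt x₀ (p + q) = fun y => polyAt x₀ p y + polyAt x₀ q y := by ext; simp [polyAt]
    rw [this, fderiv_fun_add (differentiable_polyAt x₀ p y) (differentiable_polyAt x₀ q y),
      add_apply, hp, hq]
    simp [polyAt]
  | mul_X p j hp =>
    have h1 : HasFDerivAt (fun y : EuclideanSpace ℝ (Fin d) => ((y j - x₀ j : ℝ) : ℂ))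
        (Complex.ofRealCLM.comp (EuclideanSpace.proj j : EuclideanSpace ℝ (Fin d) →L[ℝ] ℝ)) y :=
      Complex.ofRealCLM.hasFDerivAt.comp y
        (((EuclideanSpace.proj j : EuclideanSpace ℝ (Fin d) →L[ℝ] ℝ).hasFDerivAt).sub_const _)
    have h2 : polyAt x₀ (p * X j) = fun y => polyAt x₀ p y * ((y j - x₀ j : ℝ) : ℂ) := by
      ext; simp [polyAt]
    have h3 : HasFDerivAt (polyAt x₀ (p * X j)) _ y :=
      ((differentiable_polyAt x₀ p y).hasFDerivAt.mul h1).congr_of_eventuallyEq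
        (.of_forall fun z => congrFun h2 z)
    rw [h3.fderiv, pderiv_mul]
    by_cases hij : i = j
    · subst hij
      rw [add_apply, smul_apply, smul_apply, hp]
      simp [polyAt]
      ring
    · rw [add_apply, smul_apply, smul_apply, hp]
      simp [polyAt, pderiv_X_of_ne (Ne.symm hij), Ne.symm hij]
      ring

lemma polyAt_sqNormPoly (y : EuclideanSpace ℝ (Fin d)) :
    polyAt x₀ (sqNormPoly d) y = ((‖y - x₀‖ ^ 2 : ℝ) : ℂ) := by
  simp [polyAt, sqNormPoly, EuclideanSpace.real_norm_sq_eq]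

/-- The function `y ↦ P (y - x₀) ψ(|y - x₀|²)`. -/
noncomputable def radialMul (P : MvPolynomial (Fin d) ℂ) (ψ : ℝ → ℝ) :
    EuclideanSpace ℝ (Fin d) → ℂ :=
  fun y => polyAt x₀ P y * ((ψ (‖y - x₀‖ ^ 2) : ℝ) : ℂ)

lemma contDiff_radialMul (P : MvPolynomial (Fin d) ℂ) {ψ : ℝ → ℝ} {n : WithTop ℕ∞}
    (hψ : ContDiff ℝ n ψ) : ContDiff ℝ n (radialMul x₀ P ψ) :=
  (contDiff_polyAt x₀ P).mul (Complex.ofRealCLM.contDiff.comp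
    (hψ.comp ((contDiff_norm_sq ℝ).comp (contDiff_id.sub contDiff_const))))

lemma fderiv_radialMul (P : MvPolynomial (Fin d) ℂ) {ψ : ℝ → ℝ} (hψ : Differentiable ℝ ψ)
    (y : EuclideanSpace ℝ (Fin d)) (i : Fin d) :
    fderiv ℝ (radialMul x₀ P ψ) y (EuclideanSpace.single i 1) =
      radialMul x₀ (pderiv i P) ψ y + radialMul x₀ (2 * X i * P) (deriv ψ) y := by
  have h0 : HasFDerivAt (fun y : EuclideanSpace ℝ (Fin d) => y - x₀) (.id ℝ _) y :=
    (hasFDerivAt_id y).sub_const _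
  have h1 := h0.norm_sq
  have h2 := (hψ (‖y - x₀‖ ^ 2)).hasDerivAt.comp_hasFDerivAt y h1
  have h3 := Complex.ofRealCLM.hasFDerivAt.comp y h2
  have h4 := (differentiable_polyAt x₀ P y).hasFDerivAt.mul h3
  have h5 : HasFDerivAt (radialMul x₀ P ψ) _ y := h4
  rw [h5.fderiv]
  have := fderiv_polyAt x₀ P y i
  simp [radialMul, this, polyAt, EuclideanSpace.inner_single_right]
  ring

/-- The Laplacian as the sum of the iterated partial derivatives. -/
lemma laplacian_eq_sum_fderiv {F : Type*} [NormedAddCommGroup F] [NormedSpace ℝ F]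
    {φ : EuclideanSpace ℝ (Fin d) → F} (hφ : ContDiff ℝ 2 φ) (y : EuclideanSpace ℝ (Fin d)) :
    Δ φ y = ∑ i, fderiv ℝ (fun z => fderiv ℝ φ z (EuclideanSpace.single i 1)) y
      (EuclideanSpace.single i 1) := by
  rw [InnerProductSpace.laplacian_eq_iteratedFDeriv_orthonormalBasis φ
    (EuclideanSpace.basisFun (Fin d) ℝ)]
  refine Finset.sum_congr rfl fun i _ => ?_
  rw [iteratedFDeriv_two_apply, fderiv_clm_apply]
  · simp
  · exact ((hφ.fderiv_right (m := 1) (by norm_num)).differentiable one_ne_zero) y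
  · exact differentiableAt_const _

lemma laplacian_polyAt (P : MvPolynomial (Fin d) ℂ) (y : EuclideanSpace ℝ (Fin d)) :
    Δ (polyAt x₀ P) y = polyAt x₀ (polyLaplacian d P) y := by
  rw [laplacian_eq_sum_fderiv (contDiff_polyAt x₀ P)]
  simp_rw [fderiv_polyAt, polyLaplacian_apply]
  simp [polyAt]

/-- On `P ψ(|x|²)` with `P` homogeneous harmonic of degree `k`, the Laplacian acts as an ordinary
differential operator in `s = |x|²`. -/
lemma laplacian_radialMul {k : ℕ} {P : MvPolynomial (Fin d) ℂ} (hP : P ∈ harmonicHomogeneous d k)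
    {ψ : ℝ → ℝ} (hψ : ContDiff ℝ 2 ψ) (y : EuclideanSpace ℝ (Fin d)) :
    Δ (radialMul x₀ P ψ) y =
      radialMul x₀ P (fun s => 4 * (s * deriv (deriv ψ) s + (k + (d : ℝ) / 2) * deriv ψ s)) y := by
  obtain ⟨hhom, hlap⟩ := mem_harmonicHomogeneous.1 hP
  have hψ1 : Differentiable ℝ ψ := hψ.differentiable (by norm_num)
  have hψ' : ContDiff ℝ 1 (deriv ψ) := by
    have : ContDiff ℝ (1 + 1) ψ := by simpa [one_add_one_eq_two] using hψ
    exact (contDiff_succ_iff_deriv.1 this).2.2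
  have hψ2 : Differentiable ℝ (deriv ψ) := hψ'.differentiable one_ne_zero
  have hd : ∀ Q : MvPolynomial (Fin d) ℂ, ∀ {χ : ℝ → ℝ}, ContDiff ℝ 1 χ →
      DifferentiableAt ℝ (radialMul x₀ Q χ) y := fun Q χ hχ =>
    (contDiff_radialMul x₀ Q hχ).differentiable one_ne_zero y
  rw [laplacian_eq_sum_fderiv (contDiff_radialMul x₀ P hψ)]
  simp_rw [fderiv_radialMul x₀ P hψ1]
  have hterm : ∀ i, fderiv ℝ (fun z => radialMul x₀ (pderiv i P) ψ z +
      radialMul x₀ (2 * X i * P) (deriv ψ) z) y (EuclideanSpace.single i 1) =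
      polyAt x₀ (pderiv i (pderiv i P)) y * ((ψ (‖y - x₀‖ ^ 2) : ℝ) : ℂ) +
      (4 * polyAt x₀ (X i * pderiv i P) y + 2 * polyAt x₀ P y) * ((deriv ψ (‖y - x₀‖ ^ 2) : ℝ) : ℂ) +
      4 * polyAt x₀ (X i ^ 2) y * polyAt x₀ P y * ((deriv (deriv ψ) (‖y - x₀‖ ^ 2) : ℝ) : ℂ) := by
    intro i
    rw [fderiv_fun_add (hd _ (hψ.of_le (by norm_num))) (hd _ hψ'), add_apply,
      fderiv_radialMul x₀ _ hψ1, fderiv_radialMul x₀ _ hψ2]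
    have h2 : pderiv i (2 : MvPolynomial (Fin d) ℂ) = 0 := pderiv_C (a := (2 : ℂ))
    simp [radialMul, polyAt, h2]
    ring
  simp_rw [hterm]
  rw [Finset.sum_add_distrib, Finset.sum_add_distrib, ← Finset.sum_mul, ← Finset.sum_mul,
    ← Finset.sum_mul, ← Finset.sum_mul, Finset.sum_add_distrib, ← Finset.mul_sum, ← Finset.mul_sum]
  have e1 : ∑ i, polyAt x₀ (pderiv i (pderiv i P)) y = 0 := by
    have : ∑ i, polyAt x₀ (pderiv i (pderiv i P)) y = polyAt x₀ (polyLaplacian d P) y := by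
      simp [polyLaplacian_apply, polyAt]
    rw [this, hlap]
    simp [polyAt]
  have e2 : ∑ i, polyAt x₀ (X i * pderiv i P) y = k * polyAt x₀ P y := by
    have := congrArg (fun Q => polyAt x₀ Q y) hhom.sum_X_mul_pderiv
    simpa [polyAt] using this
  have e3 : ∑ i, polyAt x₀ (X i ^ 2) y = ((‖y - x₀‖ ^ 2 : ℝ) : ℂ) := by
    rw [← polyAt_sqNormPoly]
    simp [polyAt, sqNormPoly]
  rw [e1, e2, ← Finset.mul_sum, e3]
  simp [radialMul]
  ring

end PolynomialFunctions

/-! ### Radial moments of weakly harmonic functions -/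

section RadialMoments

open MvPolynomial

variable {d : ℕ}

/-- The defining property of `h²(Ω)`, for complex-valued test functions. -/
lemma setIntegral_laplacian_mul_eq_zero {Ω : Set (EuclideanSpace ℝ (Fin d))}
    {f : Lp ℂ 2 (volume.restrict Ω)} (hf : f ∈ harmonicBergman Ω)
    {Φ : EuclideanSpace ℝ (Fin d) → ℂ} (hΦ : ContDiff ℝ ∞ Φ) (hc : HasCompactSupport Φ)
    (hs : tsupport Φ ⊆ Ω) : ∫ y in Ω, Δ Φ y * f y = 0 := by
  have hre : IsTestFunction Ω (Complex.reCLM ∘ Φ) :=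
    ⟨Complex.reCLM.contDiff.comp hΦ, hc.comp_left (map_zero _),
      (closure_mono (Function.support_comp_subset (map_zero _) _)).trans hs⟩
  have him : IsTestFunction Ω (Complex.imCLM ∘ Φ) :=
    ⟨Complex.imCLM.contDiff.comp hΦ, hc.comp_left (map_zero _),
      (closure_mono (Function.support_comp_subset (map_zero _) _)).trans hs⟩
  have h2 : ∀ y, ContDiffAt ℝ 2 Φ y := fun y => (hΦ.of_le (WithTop.coe_le_coe.mpr le_top)).contDiffAt
  have hsplit : ∀ y, Δ Φ y * f y =
      Δ (Complex.reCLM ∘ Φ) y • f y + Complex.I * (Δ (Complex.imCLM ∘ Φ) y • f y) := by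
    intro y
    rw [(h2 y).laplacian_CLM_comp_left, (h2 y).laplacian_CLM_comp_left]
    simp only [Function.comp_apply, Complex.reCLM_apply, Complex.imCLM_apply, Complex.real_smul]
    conv_lhs => rw [← Complex.re_add_im (Δ Φ y)]
    ring
  have hint : ∀ {φ : EuclideanSpace ℝ (Fin d) → ℝ}, IsTestFunction Ω φ →
      Integrable (fun y => Δ φ y • f y) (volume.restrict Ω) := by
    intro φ hφ
    have := (hφ.memLp_laplacian (volume.restrict Ω)).integrable_mul (Lp.memLp f)
    refine this.congr (.of_forall fun y => ?_)
    simp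
  simp_rw [hsplit]
  rw [integral_add (hint hre) ((hint him).const_mul _), integral_const_mul, hf _ hre, hf _ him]
  simp

variable {x₀ : EuclideanSpace ℝ (Fin d)} {R : ℝ}

/-- Testing the equation `Δ f = 0` with `P ψ(|x|²)`, where `ψ' = η`. -/
lemma setIntegral_radialMul_eq_zero {f : Lp ℂ 2 (volume.restrict (Metric.ball x₀ R))}
    (hf : f ∈ harmonicBergman (Metric.ball x₀ R)) (hR : 0 < R) {k : ℕ}
    {P : MvPolynomial (Fin d) ℂ} (hP : P ∈ harmonicHomogeneous d k) {η : ℝ → ℝ}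
    (hη : ContDiff ℝ ∞ η) {a : ℝ} (ha : a < R ^ 2) (hηa : ∀ s, a ≤ s → η s = 0) :
    ∫ y in Metric.ball x₀ R,
      radialMul x₀ P (fun s => s * deriv η s + (k + (d : ℝ) / 2) * η s) y * f y = 0 := by
  -- the primitive of `η` that vanishes for `s ≥ a`
  set ψ : ℝ → ℝ := fun s => ∫ t in a..s, η t with hψ
  have hder : ∀ s, HasDerivAt ψ (η s) s := fun s =>
    hη.continuous.integral_hasStrictDerivAt a s |>.hasDerivAt
  have hderiv : deriv ψ = η := funext fun s => (hder s).deriv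
  have hψsm : ContDiff ℝ ∞ ψ := by
    rw [contDiff_infty_iff_deriv]
    exact ⟨fun s => (hder s).differentiableAt, hderiv ▸ hη⟩
  have hψa : ∀ s, a ≤ s → ψ s = 0 := by
    intro s hs
    refine intervalIntegral.integral_zero_ae (.of_forall fun t ht => hηa t ?_)
    rw [uIoc_of_le hs] at ht
    exact ht.1.le
  have hsupp : Function.support (radialMul x₀ P ψ) ⊆ Metric.closedBall x₀ (√a) := by
    intro y hy
    by_contra hout
    rw [Metric.mem_closedBall, dist_eq_norm, not_le] at hout
    refine hy ?_
    have : a ≤ ‖y - x₀‖ ^ 2 := (Real.sqrt_lt' ((Real.sqrt_nonneg a).trans_lt hout)).1 hout |>.le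
    simp [radialMul, hψa _ this]
  have hsub : Metric.closedBall x₀ (√a) ⊆ Metric.ball x₀ R :=
    Metric.closedBall_subset_ball ((Real.sqrt_lt' hR).2 ha)
  have key := setIntegral_laplacian_mul_eq_zero hf (contDiff_radialMul x₀ P hψsm)
    (HasCompactSupport.of_support_subset_isCompact (isCompact_closedBall _ _) hsupp)
    ((closure_minimal hsupp Metric.isClosed_closedBall).trans hsub)
  simp_rw [laplacian_radialMul x₀ hP (hψsm.of_le (WithTop.coe_le_coe.mpr le_top)),
    hderiv] at key
  have h4 : ∀ y, radialMul x₀ P (fun s => 4 * (s * deriv η s + (k + (d : ℝ) / 2) * η s)) y * f y =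
      4 * (radialMul x₀ P (fun s => s * deriv η s + (k + (d : ℝ) / 2) * η s) y * f y) := by
    intro y
    simp only [radialMul]
    push_cast
    ring
  simp_rw [h4] at key
  rw [integral_const_mul] at key
  simpa using key

/-- A smooth truncation of the identity: it equals `t` for `t ≤ -2` and `0` for `t ≥ -1`. -/
noncomputable def smoothNegPart (t : ℝ) : ℝ := t * Real.smoothTransition (-1 - t)

lemma contDiff_smoothNegPart : ContDiff ℝ ∞ smoothNegPart :=
  contDiff_id.mul (Real.smoothTransition.contDiff.comp (contDiff_const.sub contDiff_id))

lemma smoothNegPart_eq_zero {t : ℝ} (ht : -1 ≤ t) : smoothNegPart t = 0 := by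
  rw [smoothNegPart, Real.smoothTransition.zero_of_nonpos (by linarith), mul_zero]

lemma smoothNegPart_eq_self {t : ℝ} (ht : t ≤ -2) : smoothNegPart t = t := by
  rw [smoothNegPart, Real.smoothTransition.one_of_one_le (by linarith), mul_one]

lemma abs_smoothNegPart_le (t : ℝ) : |smoothNegPart t| ≤ |t| := by
  rw [smoothNegPart, abs_mul, abs_of_nonneg (Real.smoothTransition.nonneg _)]
  exact mul_le_of_le_one_right (abs_nonneg t) (Real.smoothTransition.le_one _)

lemma deriv_smoothNegPart_eq_one {t : ℝ} (ht : t < -2) : deriv smoothNegPart t = 1 := by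
  have : smoothNegPart =ᶠ[𝓝 t] id := by
    filter_upwards [Iio_mem_nhds ht] with s hs using smoothNegPart_eq_self (le_of_lt hs)
  rw [this.deriv_eq, deriv_id]

lemma exists_abs_deriv_smoothNegPart_le : ∃ C, ∀ t, |deriv smoothNegPart t| ≤ C := by
  have hcont : Continuous (deriv smoothNegPart) :=
    contDiff_smoothNegPart.continuous_deriv (by exact_mod_cast le_top)
  obtain ⟨C, hC⟩ := (isCompact_Icc (a := (-2 : ℝ)) (b := -1)).exists_bound_of_continuousOn
    hcont.continuousOn
  refine ⟨max C 1, fun t => ?_⟩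
  rcases lt_or_ge t (-2) with h | h
  · rw [deriv_smoothNegPart_eq_one h]
    simp
  rcases le_or_gt t (-1) with h' | h'
  · exact (hC t ⟨h, h'⟩).trans (le_max_left _ _)
  · have : smoothNegPart =ᶠ[𝓝 t] fun _ => 0 := by
      filter_upwards [Ioi_mem_nhds h'] with s hs using smoothNegPart_eq_zero (le_of_lt hs)
    rw [this.deriv_eq]
    simp

lemma integrable_mul_Lp {g : EuclideanSpace ℝ (Fin d) → ℂ} (hg : Continuous g)
    (f : Lp ℂ 2 (volume.restrict (Metric.ball x₀ R))) :
    Integrable (fun y => g y * f y) (volume.restrict (Metric.ball x₀ R)) := by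
  have hf : Integrable f (volume.restrict (Metric.ball x₀ R)) := by
    have : IsFiniteMeasure (volume.restrict (Metric.ball x₀ R)) :=
      isFiniteMeasure_restrict.2 measure_ball_lt_top.ne
    exact (Lp.memLp f).integrable (by norm_num)
  obtain ⟨C, hC⟩ := (isCompact_closedBall x₀ R).exists_bound_of_continuousOn hg.continuousOn
  refine hf.bdd_mul (c := C) hg.aestronglyMeasurable ?_
  filter_upwards [ae_restrict_mem Metric.isOpen_ball.measurableSet] with y hy
  exact hC y (Metric.ball_subset_closedBall hy)

/-- The integrals of `f P` over concentric spheres are proportional to a fixed power of the radius, so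
the radial moments over the ball are all multiples of the zeroth one. In terms of the test functions
`P ψ(|x|²)` and `β = k + d / 2`, this is the identity `∫ f P (s ψ'' + β ψ') = 0` for
`ψ' = s ^ i - R ^ (2 i)`. This `ψ'` vanishes on the boundary of the ball, but not near it, and is
therefore truncated where it is close to `0`. -/
lemma setIntegral_sq_pow_mul {f : Lp ℂ 2 (volume.restrict (Metric.ball x₀ R))}
    (hf : f ∈ harmonicBergman (Metric.ball x₀ R)) (hR : 0 < R) {k : ℕ}
    {P : MvPolynomial (Fin d) ℂ} (hP : P ∈ harmonicHomogeneous d k) (i : ℕ) :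
    ((k + (d : ℝ) / 2 + i : ℝ) : ℂ) *
      ∫ y in Metric.ball x₀ R, polyAt x₀ (sqNormPoly d ^ i * P) y * f y =
    ((k + (d : ℝ) / 2 : ℝ) * (R ^ 2) ^ i : ℝ) * ∫ y in Metric.ball x₀ R, polyAt x₀ P y * f y := by
  rcases Nat.eq_zero_or_pos i with rfl | hi
  · simp
  set β : ℝ := k + (d : ℝ) / 2 with hβ
  have hβ0 : 0 ≤ β := by positivity
  set A : ℝ := R ^ 2 with hA
  have hA0 : 0 < A := by positivity
  set q : ℝ → ℝ := fun s => s ^ i - A ^ i with hq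
  set q' : ℝ → ℝ := fun s => i * s ^ (i - 1) with hq'
  have hqd : ∀ s, HasDerivAt q (q' s) s := fun s => (hasDerivAt_pow i s).sub_const _
  have hqc : ContDiff ℝ ∞ q := (contDiff_id.pow i).sub contDiff_const
  have hqneg : ∀ s, 0 ≤ s → s < A → q s < 0 := fun s h0 hs =>
    sub_neg.2 (pow_lt_pow_left₀ hs h0 hi.ne')
  -- `η n` converges to `q` together with its derivative on `[0, A)`, and vanishes near `A`
  set η : ℕ → ℝ → ℝ := fun n s => smoothNegPart ((n + 1) * q s) / (n + 1) with hη
  have hηsm : ∀ n, ContDiff ℝ ∞ (η n) := fun n =>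
    (contDiff_smoothNegPart.comp (contDiff_const.mul hqc)).div_const _
  have hηd : ∀ n s, deriv (η n) s = deriv smoothNegPart ((n + 1) * q s) * q' s := by
    intro n s
    have hdf : DifferentiableAt ℝ smoothNegPart ((n + 1) * q s) :=
      (contDiff_smoothNegPart.differentiable (by simp)) _
    have := (hdf.hasDerivAt.comp s ((hqd s).const_mul ((n : ℝ) + 1))).div_const ((n : ℝ) + 1)
    refine this.deriv.trans ?_
    field_simp
  have hcut : ∀ n : ℕ, ∃ a, a < A ∧ ∀ s, a ≤ s → η n s = 0 := by
    intro n
    have hev : ∀ᶠ s in 𝓝[<] A, -1 < ((n : ℝ) + 1) * q s := by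
      have hct : Continuous fun s => ((n : ℝ) + 1) * q s := continuous_const.mul hqc.continuous
      refine (hct.continuousAt.eventually_const_lt ?_).filter_mono nhdsWithin_le_nhds
      simp [hq]
    obtain ⟨a, ha, haA⟩ := (hev.and (Ioo_mem_nhdsLT hA0)).exists
    refine ⟨a, haA.2, fun s hs => ?_⟩
    have : q a ≤ q s := sub_le_sub_right (pow_le_pow_left₀ haA.1.le hs i) _
    have h2 : ((n : ℝ) + 1) * q a ≤ (n + 1) * q s := by gcongr
    simp only [hη]
    rw [smoothNegPart_eq_zero (ha.le.trans h2), zero_div]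
  have hzero : ∀ n, ∫ y in Metric.ball x₀ R, radialMul x₀ P (fun s => s * deriv (η n) s + β * η n s) y * f y = 0 := by
    intro n
    obtain ⟨a, h1, h2⟩ := hcut n
    exact setIntegral_radialMul_eq_zero hf hR hP (hηsm n) h1 h2
  obtain ⟨C, hC⟩ := exists_abs_deriv_smoothNegPart_le
  have hlim : Tendsto (fun n => ∫ y in Metric.ball x₀ R, radialMul x₀ P
      (fun s => s * deriv (η n) s + β * η n s) y * f y) atTop
      (𝓝 (∫ y in Metric.ball x₀ R, radialMul x₀ P (fun s => s * q' s + β * q s) y * f y)) := by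
    refine tendsto_integral_of_dominated_convergence
      (fun y => (A * (C * (i * A ^ (i - 1))) + β * A ^ i) * ‖polyAt x₀ P y * f y‖) ?_ ?_ ?_ ?_
    · intro n
      have hcont : Continuous (radialMul x₀ P (fun s => s * deriv (η n) s + β * η n s)) := by
        have h1 : Continuous (deriv (η n)) := (hηsm n).continuous_deriv (by exact_mod_cast le_top)
        have h2 := (hηsm n).continuous
        have h3 := continuous_polyAt x₀ P
        unfold radialMul
        fun_prop
      exact (integrable_mul_Lp hcont f).aestronglyMeasurable
    · exact (integrable_mul_Lp (continuous_polyAt x₀ P) f).norm.const_mul _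
    · intro n
      filter_upwards [ae_restrict_mem Metric.isOpen_ball.measurableSet] with y hy
      set s := ‖y - x₀‖ ^ 2 with hs
      have hs0 : 0 ≤ s := by positivity
      have hsA : s ≤ A := by
        rw [Metric.mem_ball, dist_eq_norm] at hy
        exact pow_le_pow_left₀ (norm_nonneg _) hy.le 2
      have hb1 : |deriv (η n) s| ≤ C * (i * A ^ (i - 1)) := by
        rw [hηd, abs_mul]
        refine mul_le_mul (hC _) ?_ (abs_nonneg _) ((abs_nonneg _).trans (hC 0))
        rw [abs_of_nonneg (by positivity)]
        simp only [hq']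
        gcongr
      have hb2 : |η n s| ≤ A ^ i := by
        simp only [hη]
        rw [abs_div, abs_of_pos (by positivity : (0 : ℝ) < n + 1), div_le_iff₀ (by positivity)]
        refine (abs_smoothNegPart_le _).trans ?_
        rw [abs_mul, abs_of_pos (by positivity : (0 : ℝ) < n + 1), mul_comm]
        gcongr
        simp only [hq]
        rw [abs_sub_comm, abs_of_nonneg (sub_nonneg.2 (pow_le_pow_left₀ hs0 hsA i))]
        linarith [pow_nonneg hs0 i]
      have hb : |s * deriv (η n) s + β * η n s| ≤ A * (C * (i * A ^ (i - 1))) + β * A ^ i := by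
        refine (abs_add_le _ _).trans (add_le_add ?_ ?_)
        · rw [abs_mul, abs_of_nonneg hs0]
          exact mul_le_mul hsA hb1 (abs_nonneg _) hA0.le
        · rw [abs_mul, abs_of_nonneg hβ0]
          exact mul_le_mul_of_nonneg_left hb2 hβ0
      have heq : radialMul x₀ P (fun s => s * deriv (η n) s + β * η n s) y * f y =
          ((s * deriv (η n) s + β * η n s : ℝ) : ℂ) * (polyAt x₀ P y * f y) := by
        simp only [radialMul, ← hs]
        ring
      rw [heq, norm_mul, Complex.norm_real, Real.norm_eq_abs]
      gcongr
    · filter_upwards [ae_restrict_mem Metric.isOpen_ball.measurableSet] with y hy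
      set s := ‖y - x₀‖ ^ 2 with hs
      have hsA : s < A := by
        rw [Metric.mem_ball, dist_eq_norm] at hy
        exact pow_lt_pow_left₀ hy (norm_nonneg _) two_ne_zero
      have hqs := hqneg s (by positivity) hsA
      refine tendsto_const_nhds.congr' ?_
      have hev : ∀ᶠ n : ℕ in atTop, ((n : ℝ) + 1) * q s < -2 := by
        have h1 : Tendsto (fun n : ℕ => ((n : ℝ) + 1) * q s) atTop atBot :=
          (tendsto_natCast_atTop_atTop.atTop_add tendsto_const_nhds).atTop_mul_const_of_neg hqs
        exact h1.eventually_lt_atBot (-2)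
      filter_upwards [hev] with n hn
      have h1 : η n s = q s := by
        simp only [hη]
        rw [smoothNegPart_eq_self hn.le]
        field_simp
      have h2 : deriv (η n) s = q' s := by
        rw [hηd, deriv_smoothNegPart_eq_one hn, one_mul]
      simp only [radialMul, ← hs, h1, h2]
  have hfin : ∫ y in Metric.ball x₀ R, radialMul x₀ P (fun s => s * q' s + β * q s) y * f y = 0 :=
    tendsto_nhds_unique hlim (by simp only [hzero]; exact tendsto_const_nhds)
  -- here `s q' + β q = (β + i) s ^ i - β A ^ i`
  have hexp : ∀ y, radialMul x₀ P (fun s => s * q' s + β * q s) y * f y =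
      ((β + i : ℝ) : ℂ) * (polyAt x₀ (sqNormPoly d ^ i * P) y * f y) -
        ((β * A ^ i : ℝ) : ℂ) * (polyAt x₀ P y * f y) := by
    intro y
    have h1 : polyAt x₀ (sqNormPoly d ^ i * P) y =
        ((‖y - x₀‖ ^ 2 : ℝ) : ℂ) ^ i * polyAt x₀ P y := by
      rw [← polyAt_sqNormPoly]
      simp [polyAt]
    have h2 : ‖y - x₀‖ ^ 2 * q' (‖y - x₀‖ ^ 2) = i * (‖y - x₀‖ ^ 2) ^ i := by
      obtain ⟨j, rfl⟩ := Nat.exists_eq_add_of_le' hi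
      simp only [hq', Nat.add_sub_cancel]
      ring
    simp only [radialMul]
    rw [h1, h2]
    simp only [hq]
    push_cast
    ring
  simp_rw [hexp] at hfin
  rw [integral_sub ((integrable_mul_Lp (continuous_polyAt x₀ _) f).const_mul _)
    ((integrable_mul_Lp (continuous_polyAt x₀ _) f).const_mul _), integral_const_mul,
    integral_const_mul, sub_eq_zero] at hfin
  exact hfin

end RadialMoments

/-! ### Homogeneous harmonic polynomials in `h²` of a ball -/

section Completeness

open MvPolynomial

variable {d : ℕ}

/-- Green's identity on the whole space, with one factor compactly supported. -/
lemma integral_mul_laplacian_eq {φ h : EuclideanSpace ℝ (Fin d) → ℂ} (hφ : ContDiff ℝ 2 φ)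
    (hc : HasCompactSupport φ) (hh : ContDiff ℝ 2 h) :
    ∫ y, h y * Δ φ y = ∫ y, Δ h y * φ y := by
  set e : Fin d → EuclideanSpace ℝ (Fin d) := fun i => EuclideanSpace.single i 1 with he
  have hD : ∀ {g : EuclideanSpace ℝ (Fin d) → ℂ}, ContDiff ℝ 2 g → ∀ i,
      ContDiff ℝ 1 fun z => fderiv ℝ g z (e i) := fun hg i =>
    (hg.fderiv_right (m := 1) (by norm_num)).clm_apply contDiff_const
  have hDD : ∀ {g : EuclideanSpace ℝ (Fin d) → ℂ}, ContDiff ℝ 2 g → ∀ i,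
      Continuous fun z => fderiv ℝ (fun z => fderiv ℝ g z (e i)) z (e i) := fun hg i =>
    (((hD hg i).fderiv_right (m := 0) (by norm_num)).clm_apply contDiff_const).continuous
  have hcD : ∀ i, HasCompactSupport fun z => fderiv ℝ φ z (e i) := fun i => hc.fderiv_apply ℝ (e i)
  have hcDD : ∀ i, HasCompactSupport fun z => fderiv ℝ (fun z => fderiv ℝ φ z (e i)) z (e i) :=
    fun i => (hcD i).fderiv_apply ℝ (e i)
  have hi : ∀ {u v : EuclideanSpace ℝ (Fin d) → ℂ}, Continuous u → Continuous v →
      HasCompactSupport v → Integrable fun z => u z * v z := fun hu hv hvc =>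
    (hu.mul hv).integrable_of_hasCompactSupport hvc.mul_left
  have hpart : ∀ i, ∫ y, h y * fderiv ℝ (fun z => fderiv ℝ φ z (e i)) y (e i) =
      ∫ y, fderiv ℝ (fun z => fderiv ℝ h z (e i)) y (e i) * φ y := by
    intro i
    have hcont := (hD hφ i).continuous
    have hcont' := (hD hh i).continuous
    rw [integral_mul_fderiv_eq_neg_fderiv_mul_of_integrable (hi hcont' hcont (hcD i))
      (hi hh.continuous (hDD hφ i) (hcDD i)) (hi hh.continuous hcont (hcD i))
      (fun y _ => hh.differentiable two_ne_zero y)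
      (fun y _ => (hD hφ i).differentiable one_ne_zero y),
      integral_mul_fderiv_eq_neg_fderiv_mul_of_integrable (hi (hDD hh i) hφ.continuous hc)
      (hi hcont' hcont (hcD i)) (hi hcont' hφ.continuous hc)
      (fun y _ => (hD hh i).differentiable one_ne_zero y)
      (fun y _ => hφ.differentiable two_ne_zero y), neg_neg]
  simp_rw [laplacian_eq_sum_fderiv hφ, laplacian_eq_sum_fderiv hh, Finset.mul_sum, Finset.sum_mul]
  rw [integral_finsetSum _ fun i _ => hi hh.continuous (hDD hφ i) (hcDD i),
    integral_finsetSum _ fun i _ => hi (hDD hh i) hφ.continuous hc]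
  exact Finset.sum_congr rfl fun i _ => hpart i

variable (x₀ : EuclideanSpace ℝ (Fin d)) (R : ℝ)

lemma memLp_polyAt (P : MvPolynomial (Fin d) ℂ) :
    MemLp (polyAt x₀ P) 2 (volume.restrict (Metric.ball x₀ R)) := by
  have : IsFiniteMeasure (volume.restrict (Metric.ball x₀ R)) :=
    isFiniteMeasure_restrict.2 measure_ball_lt_top.ne
  obtain ⟨C, hC⟩ := (isCompact_closedBall x₀ R).exists_bound_of_continuousOn
    (continuous_polyAt x₀ P).continuousOn
  refine MemLp.of_bound (continuous_polyAt x₀ P).aestronglyMeasurable C ?_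
  filter_upwards [ae_restrict_mem Metric.isOpen_ball.measurableSet] with y hy
  exact hC y (Metric.ball_subset_closedBall hy)

/-- The polynomial `P (y - x₀)` as an element of `L²(B(x₀, R))`. -/
noncomputable def polyL2 :
    MvPolynomial (Fin d) ℂ →ₗ[ℂ] Lp ℂ 2 (volume.restrict (Metric.ball x₀ R)) where
  toFun P := (memLp_polyAt x₀ R P).toLp
  map_add' P Q := by
    rw [← MemLp.toLp_add]
    exact MemLp.toLp_congr _ _ (.of_forall fun y => by simp [polyAt])
  map_smul' c P := by
    rw [RingHom.id_apply, ← MemLp.toLp_const_smul]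
    exact MemLp.toLp_congr _ _ (.of_forall fun y => by simp [polyAt])

lemma coeFn_polyL2 (P : MvPolynomial (Fin d) ℂ) :
    polyL2 x₀ R P =ᵐ[volume.restrict (Metric.ball x₀ R)] polyAt x₀ P :=
  (memLp_polyAt x₀ R P).coeFn_toLp

lemma polyL2_mem_harmonicBergman {j : ℕ} {P : MvPolynomial (Fin d) ℂ}
    (hP : P ∈ harmonicHomogeneous d j) :
    polyL2 x₀ R P ∈ harmonicBergman (Metric.ball x₀ R) := by
  intro φ hφ
  have h1 : ∫ y in Metric.ball x₀ R, Δ φ y • polyL2 x₀ R P y =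
      ∫ y in Metric.ball x₀ R, Δ φ y • polyAt x₀ P y := by
    refine integral_congr_ae ?_
    filter_upwards [coeFn_polyL2 x₀ R P] with y hy
    rw [hy]
  have hφ2 : ContDiff ℝ 2 φ := hφ.smooth.of_le (WithTop.coe_le_coe.mpr le_top)
  have h2 : ∀ y, Δ φ y • polyAt x₀ P y = polyAt x₀ P y * Δ (Complex.ofRealCLM ∘ φ) y := by
    intro y
    rw [hφ2.contDiffAt.laplacian_CLM_comp_left]
    simp [mul_comm]
  rw [h1, setIntegral_eq_integral_of_forall_compl_eq_zero]
  · simp_rw [h2]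
    rw [integral_mul_laplacian_eq (Complex.ofRealCLM.contDiff.comp hφ2)
      (hφ.compact.comp_left (map_zero _)) (contDiff_polyAt x₀ P)]
    simp_rw [laplacian_polyAt, (mem_harmonicHomogeneous.1 hP).2]
    simp [polyAt]
  · intro y hy
    have : Δ φ y = 0 := by
      by_contra h0
      exact hy (hφ.subset (support_laplacian_subset φ h0))
    rw [this, zero_smul]

/-- The polynomial with complex conjugate coefficients. -/
noncomputable def conjPoly (P : MvPolynomial (Fin d) ℂ) : MvPolynomial (Fin d) ℂ :=
  map (starRingEnd ℂ) P

lemma polyAt_conjPoly (P : MvPolynomial (Fin d) ℂ) (y : EuclideanSpace ℝ (Fin d)) :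
    polyAt x₀ (conjPoly P) y = starRingEnd ℂ (polyAt x₀ P y) := by
  rw [polyAt, polyAt, conjPoly, eval_map, ← eval₂_id, hom_eval₂]
  simp

lemma conjPoly_mem_harmonicHomogeneous {j : ℕ} {P : MvPolynomial (Fin d) ℂ}
    (hP : P ∈ harmonicHomogeneous d j) : conjPoly P ∈ harmonicHomogeneous d j := by
  obtain ⟨h1, h2⟩ := mem_harmonicHomogeneous.1 hP
  refine mem_harmonicHomogeneous.2 ⟨h1.map _, ?_⟩
  rw [polyLaplacian_apply] at h2 ⊢
  simp_rw [conjPoly, pderiv_map]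
  rw [← map_sum, h2, map_zero]

lemma conjPoly_conjPoly (P : MvPolynomial (Fin d) ℂ) : conjPoly (conjPoly P) = P := by
  rw [conjPoly, conjPoly, MvPolynomial.map_map]
  simp [MvPolynomial.map_id]

variable {x₀ R}

lemma inner_polyL2 (P : MvPolynomial (Fin d) ℂ)
    (f : Lp ℂ 2 (volume.restrict (Metric.ball x₀ R))) :
    inner ℂ (polyL2 x₀ R P) f = ∫ y in Metric.ball x₀ R, polyAt x₀ (conjPoly P) y * f y := by
  rw [L2.inner_def]
  refine integral_congr_ae ?_
  filter_upwards [coeFn_polyL2 x₀ R P] with y hy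
  rw [hy, polyAt_conjPoly]
  simp [mul_comm]

/-- Homogeneous harmonic polynomials of different degrees `j` and `k` are orthogonal on balls: the
quotient of the first and the zeroth radial moment of their product depends on `j` and not on `k`,
and on `k` and not on `j`. -/
lemma inner_polyL2_eq_zero (hR : 0 < R) {j k : ℕ} (hjk : j ≠ k) {P Q : MvPolynomial (Fin d) ℂ}
    (hP : P ∈ harmonicHomogeneous d j) (hQ : Q ∈ harmonicHomogeneous d k) :
    inner ℂ (polyL2 x₀ R P) (polyL2 x₀ R Q) = 0 := by
  have hP' := conjPoly_mem_harmonicHomogeneous hP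
  rw [inner_polyL2]
  have hcongr : ∀ S T : MvPolynomial (Fin d) ℂ,
      ∫ y in Metric.ball x₀ R, polyAt x₀ S y * polyL2 x₀ R T y =
        ∫ y in Metric.ball x₀ R, polyAt x₀ (S * T) y := by
    intro S T
    refine integral_congr_ae ?_
    filter_upwards [coeFn_polyL2 x₀ R T] with y hy
    rw [hy]
    simp [polyAt]
  have h1 := setIntegral_sq_pow_mul (polyL2_mem_harmonicBergman x₀ R hQ) hR hP' 1
  have h2 := setIntegral_sq_pow_mul (polyL2_mem_harmonicBergman x₀ R hP') hR hQ 1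
  rw [hcongr, hcongr] at h1 h2
  rw [hcongr]
  rw [mul_comm Q, show sqNormPoly d ^ 1 * Q * conjPoly P = sqNormPoly d ^ 1 * conjPoly P * Q by ring]
    at h2
  -- `A` and `B` are the zeroth and the first radial moment of `conj P * Q`
  set A := ∫ y in Metric.ball x₀ R, polyAt x₀ (conjPoly P * Q) y
  set B := ∫ y in Metric.ball x₀ R, polyAt x₀ (sqNormPoly d ^ 1 * conjPoly P * Q) y
  push_cast at h1 h2
  have h3 : ((j : ℂ) - k) * (R : ℂ) ^ 2 * A = 0 := by
    linear_combination (-(k + (d : ℂ) / 2 + 1)) * h1 + (j + (d : ℂ) / 2 + 1) * h2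
  have hjk' : (j : ℂ) - k ≠ 0 := sub_ne_zero.2 (by exact_mod_cast hjk)
  have hR' : (R : ℂ) ^ 2 ≠ 0 := pow_ne_zero 2 (by exact_mod_cast hR.ne')
  simpa [hjk', hR'] using h3

end Completeness

/-! ### Completeness, and decay on concentric balls -/

section BallEstimate

open MvPolynomial

variable {d : ℕ} {x₀ : EuclideanSpace ℝ (Fin d)} {R : ℝ}

/-- Uniform approximation of continuous functions on a ball by polynomials. -/
lemma exists_polyAt_near (x₀ : EuclideanSpace ℝ (Fin d)) (R : ℝ)
    {g : EuclideanSpace ℝ (Fin d) → ℝ} (hg : Continuous g) {ε : ℝ}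
    (hε : 0 < ε) : ∃ Q : MvPolynomial (Fin d) ℂ, ∀ y ∈ Metric.closedBall x₀ R,
      ‖(g y : ℂ) - polyAt x₀ Q y‖ ≤ ε := by
  have : CompactSpace (Metric.closedBall x₀ R) :=
    isCompact_iff_compactSpace.1 (isCompact_closedBall x₀ R)
  set coord : Fin d → C(Metric.closedBall x₀ R, ℝ) := fun i =>
    ⟨fun y => (y : EuclideanSpace ℝ (Fin d)) i - x₀ i, by fun_prop⟩ with hcoord
  set 𝒜 : Subalgebra ℝ C(Metric.closedBall x₀ R, ℝ) := (aeval (R := ℝ) coord).range with h𝒜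
  have hsep : 𝒜.SeparatesPoints := by
    intro y z hyz
    obtain ⟨i, hi⟩ : ∃ i, (y : EuclideanSpace ℝ (Fin d)) i ≠ (z : EuclideanSpace ℝ (Fin d)) i := by
      by_contra! hcon
      exact hyz (Subtype.ext (by ext i; exact hcon i))
    refine ⟨coord i, ⟨coord i, ⟨X i, by simp⟩, rfl⟩, ?_⟩
    simpa [hcoord] using hi
  have hdense := ContinuousMap.subalgebra_topologicalClosure_eq_top_of_separatesPoints 𝒜 hsep
  set G : C(Metric.closedBall x₀ R, ℝ) := ⟨fun y => g y, by fun_prop⟩ with hG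
  have hmem : G ∈ closure (𝒜 : Set C(Metric.closedBall x₀ R, ℝ)) := by
    rw [← Subalgebra.topologicalClosure_coe, hdense]
    trivial
  obtain ⟨F, ⟨Q, rfl⟩, hF⟩ := Metric.mem_closure_iff.1 hmem ε hε
  refine ⟨map (algebraMap ℝ ℂ) Q, fun y hy => ?_⟩
  have h1 := (ContinuousMap.dist_apply_le_dist (⟨y, hy⟩ : Metric.closedBall x₀ R)).trans hF.le
  have h2 : (aeval (R := ℝ) coord Q) (⟨y, hy⟩ : Metric.closedBall x₀ R) =
      eval (fun i => y i - x₀ i) Q := by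
    have := congrArg (fun φ : MvPolynomial (Fin d) ℝ →ₐ[ℝ] ℝ => φ Q)
      (comp_aeval (R := ℝ) coord (ContinuousMap.evalAlgHom ℝ ℝ (⟨y, hy⟩ : Metric.closedBall x₀ R)))
    simpa [hcoord, aeval_eq_eval] using this
  have h3 : polyAt x₀ (map (algebraMap ℝ ℂ) Q) y = ((eval (fun i => y i - x₀ i) Q : ℝ) : ℂ) := by
    rw [polyAt, eval_map, ← eval₂_id, ← Complex.coe_algebraMap, hom_eval₂]
    rfl
  rw [h3, ← Complex.ofReal_sub, Complex.norm_real, ← dist_eq_norm, ← h2]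
  exact h1

/-- An element of `h²(B)` that is orthogonal to all homogeneous harmonic polynomials is zero: its
radial moments vanish, so it is orthogonal to all polynomials. -/
lemma eq_zero_of_forall_inner_polyL2_eq_zero (hd : 1 ≤ d) (hR : 0 < R)
    {f : Lp ℂ 2 (volume.restrict (Metric.ball x₀ R))} (hf : f ∈ harmonicBergman (Metric.ball x₀ R))
    (h : ∀ j, ∀ P ∈ harmonicHomogeneous d j, inner ℂ (polyL2 x₀ R P) f = 0) : f = 0 := by
  have hharm : ∀ j, ∀ P ∈ harmonicHomogeneous d j,
      ∫ y in Metric.ball x₀ R, polyAt x₀ P y * f y = 0 := by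
    intro j P hP
    have := h j _ (conjPoly_mem_harmonicHomogeneous hP)
    rwa [inner_polyL2, conjPoly_conjPoly] at this
  -- the pairing with `f`, as a linear functional on polynomials
  set T : MvPolynomial (Fin d) ℂ →ₗ[ℂ] ℂ :=
    { toFun := fun P => ∫ y in Metric.ball x₀ R, polyAt x₀ P y * f y
      map_add' := fun P Q => by
        rw [← integral_add (integrable_mul_Lp (continuous_polyAt x₀ P) f)
          (integrable_mul_Lp (continuous_polyAt x₀ Q) f)]
        simp [polyAt, add_mul]
      map_smul' := fun c P => by
        rw [RingHom.id_apply, smul_eq_mul, ← integral_const_mul]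
        simp [polyAt, mul_assoc] } with hT
  have hTspan : ∀ n, fischerSpan d n ≤ LinearMap.ker T := by
    intro n
    refine Submodule.span_le.2 ?_
    rintro _ ⟨a, j, P, hP, -, rfl⟩
    have h1 := setIntegral_sq_pow_mul hf hR hP a
    rw [hharm j P hP, mul_zero] at h1
    have hne : ((j + (d : ℝ) / 2 + a : ℝ) : ℂ) ≠ 0 := by
      have : (0 : ℝ) < d := by exact_mod_cast hd
      exact_mod_cast (by positivity : (j + (d : ℝ) / 2 + a : ℝ) ≠ 0)
    exact (mul_eq_zero.1 h1).resolve_left hne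
  have hTzero : ∀ P, T P = 0 := by
    intro P
    rw [← sum_homogeneousComponent P, map_sum]
    exact Finset.sum_eq_zero fun n _ =>
      hTspan n (mem_fischerSpan_of_isHomogeneous hd n (homogeneousComponent_isHomogeneous n P))
  have hfint : Integrable f (volume.restrict (Metric.ball x₀ R)) := by
    simpa using integrable_mul_Lp (g := fun _ => (1 : ℂ)) continuous_const f
  have hae := Metric.isOpen_ball.ae_eq_zero_of_integral_contDiff_smul_eq_zero
    (U := Metric.ball x₀ R) (f := f) (μ := volume) ?_ ?_
  · refine Lp.ext ?_
    filter_upwards [ae_restrict_of_ae hae, ae_restrict_mem Metric.isOpen_ball.measurableSet,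
      Lp.coeFn_zero ℂ 2 (volume.restrict (Metric.ball x₀ R))] with y hy hyB h0
    rw [h0, hy hyB, Pi.zero_apply]
  · exact IntegrableOn.locallyIntegrableOn hfint
  · intro g hg _ hgs
    rw [← setIntegral_eq_integral_of_forall_compl_eq_zero (s := Metric.ball x₀ R)]
    · set I := ∫ y in Metric.ball x₀ R, ‖f y‖ with hI
      have hI0 : 0 ≤ I := integral_nonneg fun _ => norm_nonneg _
      refine norm_eq_zero.1 (le_antisymm (le_of_forall_pos_le_add fun ε hε => ?_) (norm_nonneg _))
      obtain ⟨Q, hQ⟩ := exists_polyAt_near x₀ R hg.continuous (by positivity : 0 < ε / (I + 1))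
      have hgc : Continuous fun y => (g y : ℂ) := Complex.continuous_ofReal.comp hg.continuous
      have h1 : ∫ y in Metric.ball x₀ R, g y • f y =
          ∫ y in Metric.ball x₀ R, ((g y : ℂ) - polyAt x₀ Q y) * f y := by
        have h2 : ∫ y in Metric.ball x₀ R, polyAt x₀ Q y * f y = 0 := hTzero Q
        simp_rw [sub_mul]
        rw [integral_sub (integrable_mul_Lp hgc f) (integrable_mul_Lp (continuous_polyAt x₀ Q) f),
          h2, sub_zero]
        simp
      have h3 : ‖∫ y in Metric.ball x₀ R, g y • f y‖ ≤
          ∫ y in Metric.ball x₀ R, ε / (I + 1) * ‖f y‖ := by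
        rw [h1]
        refine norm_integral_le_of_norm_le (hfint.norm.const_mul _) ?_
        filter_upwards [ae_restrict_mem Metric.isOpen_ball.measurableSet] with y hy
        rw [norm_mul]
        gcongr
        exact hQ y (Metric.ball_subset_closedBall hy)
      rw [integral_const_mul, ← hI] at h3
      refine h3.trans ?_
      rw [zero_add, div_mul_eq_mul_div, div_le_iff₀ (by positivity)]
      nlinarith
    · intro y hy
      have : g y = 0 := by
        by_contra h0
        exact hy (hgs (subset_tsupport g h0))
      rw [this, zero_smul]

/-- The homogeneous harmonic polynomials of degree `j`, as a subspace of `L²(B(x₀, R))`. -/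
noncomputable def harmonicL2 (x₀ : EuclideanSpace ℝ (Fin d)) (R : ℝ) (j : ℕ) :
    Submodule ℂ (Lp ℂ 2 (volume.restrict (Metric.ball x₀ R))) :=
  (harmonicHomogeneous d j).map (polyL2 x₀ R)

/-- An element of `h²(B)` orthogonal to the harmonic polynomials of degree less than `m` is a limit
of sums of homogeneous harmonic polynomials of degrees at least `m`. -/
lemma mem_closure_iSup_harmonicL2 (hd : 1 ≤ d) (hR : 0 < R) (m : ℕ)
    {f : Lp ℂ 2 (volume.restrict (Metric.ball x₀ R))} (hf : f ∈ harmonicBergman (Metric.ball x₀ R))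
    (h : ∀ P ∈ harmonicDegreeLT d m, inner ℂ (polyL2 x₀ R P) f = 0) :
    f ∈ (⨆ j : {j // m ≤ j}, harmonicL2 x₀ R j).topologicalClosure := by
  set U := ⨆ j : {j // m ≤ j}, harmonicL2 x₀ R j with hU
  set W := U.topologicalClosure with hW
  have : CompleteSpace W := (Submodule.isClosed_topologicalClosure U).completeSpace_coe
  have hUh : U ≤ harmonicBergman (Metric.ball x₀ R) := by
    refine iSup_le fun j => ?_
    rintro _ ⟨P, hP, rfl⟩
    exact polyL2_mem_harmonicBergman x₀ R hP
  have hWh : W ≤ harmonicBergman (Metric.ball x₀ R) :=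
    Submodule.topologicalClosure_minimal _ hUh (isClosed_harmonicBergman _)
  -- the part of `f` orthogonal to `W` is orthogonal to every homogeneous harmonic polynomial
  have hzero : f - W.starProjection f = 0 := by
    refine eq_zero_of_forall_inner_polyL2_eq_zero hd hR
      (Submodule.sub_mem _ hf (hWh (W.starProjection_apply_mem f))) fun j P hP => ?_
    rcases lt_or_ge j m with hj | hj
    · have hPW : W ≤ (ℂ ∙ polyL2 x₀ R P)ᗮ := by
        refine Submodule.topologicalClosure_minimal _ (iSup_le fun i => ?_)
          (Submodule.isClosed_orthogonal _)
        rintro _ ⟨Q, hQ, rfl⟩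
        rw [Submodule.mem_orthogonal_singleton_iff_inner_right]
        exact inner_polyL2_eq_zero hR (by have := i.2; omega) hP hQ
      have h2 := hPW (W.starProjection_apply_mem f)
      rw [Submodule.mem_orthogonal_singleton_iff_inner_right] at h2
      rw [inner_sub_right, h P (harmonicHomogeneous_le_harmonicDegreeLT hj hP), h2, sub_zero]
    · have hPW : polyL2 x₀ R P ∈ W :=
        Submodule.le_topologicalClosure _ (Submodule.mem_iSup_of_mem (⟨j, hj⟩ : {j // m ≤ j})
          ⟨P, hP, rfl⟩)
      exact W.sub_starProjection_mem_orthogonal f _ hPW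
  rw [sub_eq_zero] at hzero
  rw [hzero]
  exact W.starProjection_apply_mem f

lemma norm_sq_eq_integral_norm_sq {α : Type*} [MeasurableSpace α] {μ : Measure α}
    (f : Lp ℂ 2 μ) : ‖f‖ ^ 2 = ∫ y, ‖f y‖ ^ 2 ∂μ := by
  have h := inner_self_eq_norm_sq_to_K (𝕜 := ℂ) f
  rw [L2.inner_def] at h
  refine Complex.ofReal_injective ?_
  rw [← integral_complex_ofReal]
  refine Eq.trans ?_ (h.symm.trans (integral_congr_ae (.of_forall fun y => ?_)))
  · push_cast
    rfl
  · simp only [inner_self_eq_norm_sq_to_K]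
    push_cast
    rfl

/-- Scaling of a homogeneous polynomial of degree `j` between concentric balls. -/
lemma norm_polyL2_sq_eq {r γ : ℝ} (hγ : 0 < γ) {j : ℕ} {P : MvPolynomial (Fin d) ℂ}
    (hP : P.IsHomogeneous j) :
    ‖polyL2 x₀ (γ * r) P‖ ^ 2 = γ ^ (2 * j + d) * ‖polyL2 x₀ r P‖ ^ 2 := by
  have hn : ∀ ρ : ℝ, ‖polyL2 x₀ ρ P‖ ^ 2 =
      ∫ y, (Metric.ball (0 : EuclideanSpace ℝ (Fin d)) ρ).indicator
        (fun y => ‖polyAt 0 P y‖ ^ 2) y := by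
    intro ρ
    have h1 : ‖polyL2 x₀ ρ P‖ ^ 2 = ∫ y in Metric.ball x₀ ρ, ‖polyAt x₀ P y‖ ^ 2 := by
      rw [norm_sq_eq_integral_norm_sq]
      refine integral_congr_ae ?_
      filter_upwards [coeFn_polyL2 x₀ ρ P] with y hy
      rw [hy]
    rw [h1, ← integral_indicator Metric.isOpen_ball.measurableSet,
      ← integral_add_right_eq_self _ x₀]
    congr 1
    ext y
    simp [Set.indicator, Metric.mem_ball, dist_eq_norm, polyAt]
  have hs : ∀ y, (Metric.ball (0 : EuclideanSpace ℝ (Fin d)) (γ * r)).indicator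
      (fun y => ‖polyAt 0 P y‖ ^ 2) (γ • y) =
      γ ^ (2 * j) * (Metric.ball (0 : EuclideanSpace ℝ (Fin d)) r).indicator
        (fun y => ‖polyAt 0 P y‖ ^ 2) y := by
    intro y
    have hpol : polyAt 0 P (γ • y) = (γ : ℂ) ^ j * polyAt 0 P y := by
      rw [polyAt, polyAt, eval_eq, eval_eq, Finset.mul_sum]
      refine Finset.sum_congr rfl fun s hs => ?_
      have hdeg : ∑ i, s i = j := by
        have := hP (mem_support_iff.1 hs)
        rwa [show (1 : Fin d → ℕ) = fun _ => 1 from rfl, ← Finsupp.degree_eq_weight_one,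
          Finsupp.degree_eq_sum] at this
      have hprod : ∀ v : Fin d → ℂ, ∏ i ∈ s.support, v i ^ s i = ∏ i, v i ^ s i := fun v =>
        Finset.prod_subset (Finset.subset_univ _) fun i _ hi => by
          rw [Finsupp.notMem_support_iff.1 hi, pow_zero]
      rw [hprod, hprod, ← hdeg, ← Finset.prod_pow_eq_pow_sum, mul_left_comm,
        ← Finset.prod_mul_distrib]
      simp [mul_pow]
    have hmem : γ • y ∈ Metric.ball (0 : EuclideanSpace ℝ (Fin d)) (γ * r) ↔
        y ∈ Metric.ball (0 : EuclideanSpace ℝ (Fin d)) r := by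
      simp [norm_smul, abs_of_pos hγ, hγ]
    by_cases hy : y ∈ Metric.ball (0 : EuclideanSpace ℝ (Fin d)) r
    · rw [Set.indicator_of_mem (hmem.2 hy), Set.indicator_of_mem hy, hpol, norm_mul, mul_pow,
        norm_pow, Complex.norm_real, Real.norm_of_nonneg hγ.le]
      ring
    · rw [Set.indicator_of_notMem (fun h => hy (hmem.1 h)), Set.indicator_of_notMem hy, mul_zero]
  have hint := Measure.integral_comp_smul_of_nonneg (volume : Measure (EuclideanSpace ℝ (Fin d)))
    ((Metric.ball (0 : EuclideanSpace ℝ (Fin d)) (γ * r)).indicator fun y => ‖polyAt 0 P y‖ ^ 2)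
    γ (hR := hγ.le)
  simp_rw [hs] at hint
  rw [integral_const_mul, ← hn, ← hn, finrank_euclideanSpace_fin, smul_eq_mul] at hint
  rw [pow_add, mul_comm (γ ^ (2 * j)), mul_assoc, hint, ← mul_assoc,
    mul_inv_cancel₀ (by positivity), one_mul]

/-- An element of `h²(B(x₀, γ r))` that is orthogonal to the harmonic polynomials of degree less
than `m` shrinks by the factor `γ ^ (-(m + d / 2))` on the concentric ball `B(x₀, r)`. -/
lemma norm_restrictL2_sq_le (hd : 1 ≤ d) {r γ : ℝ} (hr : 0 < r) (hγ : 1 < γ) (m : ℕ)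
    (hsub : Metric.ball x₀ r ⊆ Metric.ball x₀ (γ * r))
    {f : Lp ℂ 2 (volume.restrict (Metric.ball x₀ (γ * r)))}
    (hf : f ∈ harmonicBergman (Metric.ball x₀ (γ * r)))
    (h : ∀ P ∈ harmonicDegreeLT d m, inner ℂ (polyL2 x₀ (γ * r) P) f = 0) :
    γ ^ (2 * m + d) * ‖restrictL2 hsub f‖ ^ 2 ≤ ‖f‖ ^ 2 := by
  have hγ0 : 0 < γ := by linarith
  have hres : ∀ P : MvPolynomial (Fin d) ℂ,
      restrictL2 hsub (polyL2 x₀ (γ * r) P) = polyL2 x₀ r P := by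
    intro P
    refine Lp.ext ?_
    filter_upwards [coeFn_restrictL2 hsub (polyL2 x₀ (γ * r) P), coeFn_polyL2 x₀ r P,
      ae_restrict_of_ae_restrict_of_subset hsub (coeFn_polyL2 x₀ (γ * r) P)] with y h1 h2 h3
    rw [h1, h2, h3]
  have hcl : IsClosed {g : Lp ℂ 2 (volume.restrict (Metric.ball x₀ (γ * r))) |
      γ ^ (2 * m + d) * ‖restrictL2 hsub g‖ ^ 2 ≤ ‖g‖ ^ 2} :=
    isClosed_le (by fun_prop) (by fun_prop)
  refine closure_minimal ?_ hcl (mem_closure_iSup_harmonicL2 hd (by positivity) m hf h)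
  intro g hg
  obtain ⟨u, hu, rfl⟩ := (Submodule.mem_iSup_iff_exists_finsupp _ _).1 hg
  choose P hP hPu using hu
  have hort : ∀ ρ : ℝ, 0 < ρ → ∀ s : Finset {j // m ≤ j},
      ‖∑ j ∈ s, polyL2 x₀ ρ (P j)‖ ^ 2 = ∑ j ∈ s, ‖polyL2 x₀ ρ (P j)‖ ^ 2 := by
    intro ρ hρ s
    have hfam : OrthogonalFamily ℂ (fun j : {j // m ≤ j} => harmonicL2 x₀ ρ j)
        fun j => (harmonicL2 x₀ ρ j).subtypeₗᵢ := by
      rintro i j hij ⟨_, Q, hQ, rfl⟩ ⟨_, S, hS, rfl⟩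
      exact inner_polyL2_eq_zero hρ (fun h => hij (Subtype.ext h)) hQ hS
    exact hfam.norm_sum (fun j => ⟨polyL2 x₀ ρ (P j), P j, hP j, rfl⟩) s
  have hsum : (u.sum fun _ v => v) = ∑ j ∈ u.support, polyL2 x₀ (γ * r) (P j) :=
    Finset.sum_congr rfl fun j _ => (hPu j).symm
  rw [Set.mem_ofPred_eq, hsum, map_sum]
  simp_rw [hres]
  rw [hort r hr, hort (γ * r) (by positivity), Finset.mul_sum]
  refine Finset.sum_le_sum fun j _ => ?_
  rw [norm_polyL2_sq_eq hγ0 (mem_harmonicHomogeneous.1 (hP j)).1]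
  gcongr
  · exact hγ.le
  · exact j.2

end BallEstimate

/-! ### Relative covers -/

section RelativeCover

variable {d : ℕ}

lemma norm_restrictL2_sq {Ω₁ Ω₂ : Set (EuclideanSpace ℝ (Fin d))} (h : Ω₂ ⊆ Ω₁)
    (f : Lp ℂ 2 (volume.restrict Ω₁)) : ‖restrictL2 h f‖ ^ 2 = ∫ y in Ω₂, ‖f y‖ ^ 2 := by
  rw [norm_sq_eq_integral_norm_sq]
  refine integral_congr_ae ?_
  filter_upwards [coeFn_restrictL2 h f] with y hy
  rw [hy]

lemma norm_restrictL2_le {Ω₁ Ω₂ : Set (EuclideanSpace ℝ (Fin d))} (h : Ω₂ ⊆ Ω₁)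
    (f : Lp ℂ 2 (volume.restrict Ω₁)) : ‖restrictL2 h f‖ ≤ ‖f‖ := by
  simpa using (restrictL2 h).le_of_opNorm_le (LinearMap.mkContinuous_norm_le _ zero_le_one _) f

lemma restrictL2_restrictL2 {Ω₁ Ω₂ Ω₃ : Set (EuclideanSpace ℝ (Fin d))} (h : Ω₂ ⊆ Ω₁)
    (h' : Ω₃ ⊆ Ω₂) (f : Lp ℂ 2 (volume.restrict Ω₁)) :
    restrictL2 h' (restrictL2 h f) = restrictL2 (h'.trans h) f := by
  refine Lp.ext ?_
  filter_upwards [coeFn_restrictL2 h' (restrictL2 h f), coeFn_restrictL2 (h'.trans h) f,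
    ae_restrict_of_ae_restrict_of_subset h' (coeFn_restrictL2 h f)] with y h1 h2 h3
  rw [h1, h2, h3]

lemma norm_restrictL2_sq_le_sum_of_subset_iUnion {ι : Type*} [Fintype ι]
    {Ω₁ Ω₂ : Set (EuclideanSpace ℝ (Fin d))} {B : ι → Set (EuclideanSpace ℝ (Fin d))}
    (h : Ω₂ ⊆ Ω₁) (hB : ∀ k, B k ⊆ Ω₁) (hcov : Ω₂ ⊆ ⋃ k, B k)
    (f : Lp ℂ 2 (volume.restrict Ω₁)) :
    ‖restrictL2 h f‖ ^ 2 ≤ ∑ k, ‖restrictL2 (hB k) f‖ ^ 2 := by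
  simp_rw [norm_restrictL2_sq]
  have hint : ∀ k, Integrable (fun y => ‖f y‖ ^ 2) (volume.restrict (B k)) := fun k =>
    (memLp_restrict_of_subset (hB k) f).integrable_norm_pow two_ne_zero
  have hle : volume.restrict Ω₂ ≤ ∑ k, volume.restrict (B k) := by
    refine (Measure.restrict_mono hcov le_rfl).trans ?_
    rw [← Measure.sum_fintype]
    exact Measure.restrict_iUnion_le
  rw [← integral_finsetSum_measure fun k _ => hint k]
  refine integral_mono_measure hle (.of_forall fun y => by positivity) ?_
  exact integrable_finsetSum_measure.2 fun k _ => hint k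

/-- On an element of `h²(Ω₁)` that is orthogonal on a ball `B(x₀, γ r) ⊆ Ω₁` to the harmonic
polynomials of degree less than `m`, the restriction to `B(x₀, r)` gains the factor
`γ ^ (-(m + d / 2))`. -/
lemma norm_restrictL2_ball_le (hd : 1 ≤ d) {Ω₁ : Set (EuclideanSpace ℝ (Fin d))}
    {x₀ : EuclideanSpace ℝ (Fin d)} {r γ : ℝ} (hr : 0 < r) (hγ : 1 < γ) (m : ℕ)
    (hsub : Metric.ball x₀ r ⊆ Metric.ball x₀ (γ * r)) (hbig : Metric.ball x₀ (γ * r) ⊆ Ω₁)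
    {f : Lp ℂ 2 (volume.restrict Ω₁)} (hf : f ∈ harmonicBergman Ω₁)
    (h : ∀ P ∈ harmonicDegreeLT d m, inner ℂ (polyL2 x₀ (γ * r) P) (restrictL2 hbig f) = 0) :
    ‖restrictL2 (hsub.trans hbig) f‖ ≤ Real.exp (-((m + (d : ℝ) / 2) * Real.log γ)) * ‖f‖ := by
  have hγ0 : 0 < γ := by linarith
  have h1 := norm_restrictL2_sq_le hd hr hγ m hsub (restrictL2_mem_harmonicBergman hbig hf) h
  rw [restrictL2_restrictL2] at h1
  have h2 : ‖restrictL2 hbig f‖ ^ 2 ≤ ‖f‖ ^ 2 :=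
    pow_le_pow_left₀ (norm_nonneg _) (norm_restrictL2_le _ _) 2
  have hpow : γ ^ (2 * m + d) = Real.exp ((m + (d : ℝ) / 2) * Real.log γ) ^ 2 := by
    rw [← Real.exp_nat_mul, ← Real.rpow_natCast γ, Real.rpow_def_of_pos hγ0]
    congr 1
    push_cast
    ring
  have h3 : (Real.exp ((m + (d : ℝ) / 2) * Real.log γ) * ‖restrictL2 (hsub.trans hbig) f‖) ^ 2 ≤
      ‖f‖ ^ 2 := by
    rw [mul_pow, ← hpow]
    exact h1.trans h2
  rw [Real.exp_neg, ← div_eq_inv_mul, le_div_iff₀' (Real.exp_pos _)]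
  exact le_of_sq_le_sq h3 (norm_nonneg _)

/-- The finite-codimensional subspace on which, for each `k`, the expansion on the ball
`B(x k, ρ k)` starts with terms of degree at least `m k`. -/
noncomputable def cutoffSubspace {e N : ℕ} (Ω₁ : Set (EuclideanSpace ℝ (Fin (e + 1))))
    (x : Fin N → EuclideanSpace ℝ (Fin (e + 1))) (ρ : Fin N → ℝ)
    (hbig : ∀ k, Metric.ball (x k) (ρ k) ⊆ Ω₁) (m : Fin N → ℕ) :
    Submodule ℂ (harmonicBergman Ω₁) :=
  LinearMap.ker (LinearMap.pi fun k =>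
    (((harmonicDegreeLT (e + 1) (m k)).map (polyL2 (x k) (ρ k))).orthogonalProjectionOnto ∘L
      restrictL2 (hbig k)).toLinearMap ∘ₗ (harmonicBergman Ω₁).subtype)

lemma inner_eq_zero_of_mem_cutoffSubspace {e N : ℕ} {Ω₁ : Set (EuclideanSpace ℝ (Fin (e + 1)))}
    {x : Fin N → EuclideanSpace ℝ (Fin (e + 1))} {ρ : Fin N → ℝ}
    (hbig : ∀ k, Metric.ball (x k) (ρ k) ⊆ Ω₁) {m : Fin N → ℕ} {v : harmonicBergman Ω₁}
    (hv : v ∈ cutoffSubspace Ω₁ x ρ hbig m) (k : Fin N) {P : MvPolynomial (Fin (e + 1)) ℂ}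
    (hP : P ∈ harmonicDegreeLT (e + 1) (m k)) :
    inner ℂ (polyL2 (x k) (ρ k) P) (restrictL2 (hbig k) v.1) = 0 :=
  Submodule.orthogonalProjectionOnto_eq_zero_iff.1 (congrFun hv k) _
    (Submodule.mem_map_of_mem hP)

lemma finrank_quotient_cutoffSubspace_le {e N : ℕ} {Ω₁ : Set (EuclideanSpace ℝ (Fin (e + 1)))}
    {x : Fin N → EuclideanSpace ℝ (Fin (e + 1))} {ρ : Fin N → ℝ}
    (hbig : ∀ k, Metric.ball (x k) (ρ k) ⊆ Ω₁) (m : Fin N → ℕ) :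
    FiniteDimensional ℂ (harmonicBergman Ω₁ ⧸ cutoffSubspace Ω₁ x ρ hbig m) ∧
      Module.finrank ℂ (harmonicBergman Ω₁ ⧸ cutoffSubspace Ω₁ x ρ hbig m) ≤
        ∑ k, harmonicCount e (m k) := by
  have := finrank_quotient_ker_pi_le (LinearMap.pi fun k =>
    (((harmonicDegreeLT (e + 1) (m k)).map (polyL2 (x k) (ρ k))).orthogonalProjectionOnto ∘L
      restrictL2 (hbig k)).toLinearMap ∘ₗ (harmonicBergman Ω₁).subtype)
  exact ⟨this.1, this.2.trans (Finset.sum_le_sum fun k _ =>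
    (Submodule.finrank_map_le _ _).trans (finrank_harmonicDegreeLT_le e (m k)))⟩

/-- Cutting off the expansion on the `k`-th enlarged ball of a relative cover at degree `m k` gives a
subspace of finite codimension on which the canonical identification is small. -/
lemma exists_submodule_norm_canonicalIdentification_le {e N : ℕ}
    {Ω₁ Ω₂ : Set (EuclideanSpace ℝ (Fin (e + 1)))} (hΩ : Ω₂ ⊆ Ω₁)
    {x : Fin N → EuclideanSpace ℝ (Fin (e + 1))} {r γ : Fin N → ℝ}
    (hB : IsRelativeCover Ω₁ Ω₂ x r γ) (m : Fin N → ℕ) {δ : ℝ} (hδ : 0 ≤ δ)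
    (hm : ∀ k, Real.exp (-((m k + ((e : ℝ) + 1) / 2) * efficiency γ k)) ≤ δ) :
    ∃ K : Submodule ℂ (harmonicBergman Ω₁), FiniteDimensional ℂ (harmonicBergman Ω₁ ⧸ K) ∧
      Module.finrank ℂ (harmonicBergman Ω₁ ⧸ K) ≤ ∑ k, harmonicCount e (m k) ∧
      ∀ v ∈ K, ‖canonicalIdentification hΩ v‖ ≤ N * δ * ‖v‖ := by
  have hbig : ∀ k, Metric.ball (x k) (γ k * r k) ⊆ Ω₁ := fun k =>
    (subset_iUnion (fun k => Metric.ball (x k) (γ k * r k)) k).trans hB.dilation_subset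
  have hsub : ∀ k, Metric.ball (x k) (r k) ⊆ Metric.ball (x k) (γ k * r k) := fun k =>
    Metric.ball_subset_ball (le_mul_of_one_le_left (hB.radius_pos k).le (hB.one_lt_scaling k).le)
  obtain ⟨hfin, hrank⟩ := finrank_quotient_cutoffSubspace_le hbig m
  refine ⟨_, hfin, hrank, fun v hv => ?_⟩
  have hk : ∀ k, ‖restrictL2 ((hsub k).trans (hbig k)) v.1‖ ^ 2 ≤ (δ * ‖v‖) ^ 2 := by
    intro k
    have h1 := norm_restrictL2_ball_le (by omega) (hB.radius_pos k) (hB.one_lt_scaling k) (m k)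
      (hsub k) (hbig k) v.2 fun P hP => inner_eq_zero_of_mem_cutoffSubspace hbig hv k hP
    have h2 := hm k
    rw [efficiency, ← Nat.cast_add_one] at h2
    exact pow_le_pow_left₀ (norm_nonneg _) (h1.trans (mul_le_mul_of_nonneg_right h2 (norm_nonneg v))) 2
  have hsum := norm_restrictL2_sq_le_sum_of_subset_iUnion hΩ (fun k => (hsub k).trans (hbig k)) hB.cover v.1
  have hN : (N : ℝ) ≤ N ^ 2 := by exact_mod_cast Nat.le_self_pow two_ne_zero N
  refine le_of_sq_le_sq ?_ (by positivity)
  calc ‖canonicalIdentification hΩ v‖ ^ 2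
      ≤ ∑ k, ‖restrictL2 ((hsub k).trans (hbig k)) v.1‖ ^ 2 := hsum
    _ ≤ ∑ _k : Fin N, (δ * ‖v‖) ^ 2 := Finset.sum_le_sum fun k _ => hk k
    _ = N * (δ * ‖v‖) ^ 2 := by simp
    _ ≤ N ^ 2 * (δ * ‖v‖) ^ 2 := by gcongr
    _ = (N * δ * ‖v‖) ^ 2 := by ring

end RelativeCover

theorem mainTheorem3 (d : ℕ) (hd : 2 ≤ d) (Ω₁ Ω₂ : Set (EuclideanSpace ℝ (Fin d)))
    (hΩ₁ : IsOpen Ω₁) (hΩ₂ : IsOpen Ω₂) (hΩ : CompactlyContained Ω₂ Ω₁)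
    (N : ℕ) (hN : 1 ≤ N) (x : Fin N → EuclideanSpace ℝ (Fin d)) (r γ : Fin N → ℝ)
    (hB : IsRelativeCover Ω₁ Ω₂ x r γ) (c : ℝ)
    (hc : c = (((d - 1).factorial : ℝ) / 2) ^ (1 / ((d : ℝ) - 1)) * effNorm (d - 1) (efficiency γ)) :
    canonicalIdentification hΩ.subset ∈
        expClass (harmonicBergman Ω₁) (harmonicBergman Ω₂) c (1 / ((d : ℝ) - 1)) ∧
      expGauge c (1 / ((d : ℝ) - 1)) (canonicalIdentification hΩ.subset) ≤
        N * Real.exp (-(effMin (efficiency γ)) / 2) := by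
  -- everything is expressed in `e = d - 1`
  obtain ⟨e, rfl⟩ := Nat.exists_eq_add_of_le' (le_trans one_le_two hd)
  have he : 1 ≤ e := by omega
  have hcast : 1 / (((e + 1 : ℕ) : ℝ) - 1) = 1 / (e : ℝ) := by push_cast; ring
  rw [hcast, Nat.add_sub_cancel] at hc
  have hΓ : ∀ k, 0 < efficiency γ k := fun k => Real.log_pos (hB.one_lt_scaling k)
  have hc0 : 0 < c := by
    have : Nonempty (Fin N) := ⟨⟨0, hN⟩⟩
    rw [hc, effNorm]
    have : 0 < ∑ j, (|efficiency γ j| ^ e)⁻¹ :=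
      Finset.sum_pos (fun k _ => by have := hΓ k; positivity) Finset.univ_nonempty
    positivity
  refine mem_expClass_and_expGauge_le _ (by positivity) hc0 (hcast ▸ by positivity) fun n hn => ?_
  have hm := exists_cutoff_degrees he (efficiency γ) hΓ hN hn
  obtain ⟨m, hm1, hm2⟩ := hm
  rw [← hc, ← hcast] at hm2
  have hδ : 0 ≤ Real.exp (-(effMin (efficiency γ)) / 2) *
      Real.exp (-(c * (n : ℝ) ^ (1 / (((e + 1 : ℕ) : ℝ) - 1)))) := by positivity
  have hK := exists_submodule_norm_canonicalIdentification_le hΩ.subset hB m hδ hm2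
  obtain ⟨K, hK1, hK2, hK3⟩ := hK
  exact ⟨K, hK1, hK2.trans_lt hm1, fun v hv => (hK3 v hv).trans_eq (by rw [← mul_assoc (N : ℝ)])⟩
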